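/- Let $d\ge 2$, $n\ge 0$ and $s\ge 2$ be integers, and let $$\mathbb V_0^{d+1}=\{(x,t)\in\mathbb R^d\times\mathbb R:\ \|x\|=t,\ 0\le t\le 1\}$$ be the conic surface, whose points are written $(x,t)=(t\xi,t)$ with $\xi\in\mathbb S^{d-1}$. Let $$\mathcal D_{\gamma}=t(1-t)\frac{d^2}{dt^2}+\bigl(d-1-(d+\gamma)t\bigr)\frac{d}{dt}+t^{-1}\Delta_0^{(\xi)},$$ acting on functions of $(\xi,t)$, where $\Delta_0^{(\xi)}$ is the Laplace–Beltrami operator of $\mathbb S^{d-1}$. Let $\mathcal H_m^{d,0}$ be the space of homogeneous harmonic polynomials of degree $m$ in $x\in\mathbb R^d$. Let $\mathcal V_m^d(\mathsf w_{\beta,\gamma})$ be the space of orthogonal polynomials of degree $m$ on $\mathbb V_0^{d+1}$, that is, the restrictions to $\mathbb V_0^{d+1}$ of polynomials of degree at most $m$ in $(x,t)$ that are orthogonal to all polynomials of degree less than $m$ with respect to $$\langle f,g\rangle_{\beta,\gamma}=\int_0^1 t^{d-1}\int_{\mathbb S^{d-1}} f(t\xi,t)\,g(t\xi,t)\,d\sigma(\xi)\;t^{\beta}(1-t)^{\gamma}\,dt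 .$$ Spaces with a negative index $m$ are zero. Let $$P_j^{(\alpha,\beta)}(z)=\frac1{j!}\sum_{k=0}^{j}\binom jk (j+\alpha+\beta+1)_k\,(\alpha+k+1)_{j-k}\Bigl(\frac{z-1}{2}\Bigr)^k$$ be the Jacobi polynomials with arbitrary real parameters. Define $\mathcal U_n^d(\mathsf w_{-1,-s})$ as the linear span, in the space of functions on $\mathbb V_0^{d+1}$, of $$\mathcal H_n^{d,0},\qquad P_j^{(2n-2j+d-2,\,-s)}(1-2t)\,\mathcal H_{n-j}^{d,0}\quad (1\le j\le s-1),\qquad (1-t)^s\,\mathcal V_{n-s}^d(\mathsf w_{-1,s}).$$ **Theorem.** Every $Z\in\mathcal U_n^d(\mathsf w_{-1,-s})$ satisfies, for $\xi\in\mathbb S^{d-1}$ and $0<t\le 1$, $$\mathcal D_{-s}Z=-n(n-s+d-1)\,Z .$$ Moreover, if for every $j$ with $1\le j\le \min(s-1,n)$ the integer $-2n-d+j+s+2$ is not between $1$ and $j$ (inclusive), i.e. if none of the Jacobi polynomials $P_j^{(2n-2j+d-2,-s)}$ involved has a degree reduction, then $\mathcal U_n^d(\mathsf w_{-1,-s})$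 has full dimension: $$\dim\mathcal U_n^d(\mathsf w_{-1,-s})=\binom{n+d-1}{d-1}+\binom{n+d-2}{d-1},$$ which is the dimension of the space of orthogonal polynomials of degree $n$ on $\mathbb V_0^{d+1}$. -/

import Mathlib

noncomputable section

namespace ConicSurface

/-- The Euclidean space `ℝ^d`. -/
abbrev E (d : ℕ) : Type := EuclideanSpace ℝ (Fin d)

/-- The conic surface `V₀^{d+1} = {(x,t) : ‖x‖ = t, 0 ≤ t ≤ 1}` in `ℝ^d × ℝ`. -/
def V0 (d : ℕ) : Set (E d × ℝ) := {p | ‖p.1‖ = p.2 ∧ 0 ≤ p.2 ∧ p.2 ≤ 1}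

open Classical in
/-- A function `f` on the conic surface in the coordinates `(x,t) = (t ξ, t)`, that is
`(ξ, t) ↦ f (t ξ, t)` for `ξ` in the unit sphere and `0 ≤ t ≤ 1`
(with the irrelevant value `0` where `(t ξ, t)` is not on the surface). -/
def polar {d : ℕ} (f : V0 d → ℝ) (ξ : E d) (t : ℝ) : ℝ :=
  if h : ((t • ξ, t) : E d × ℝ) ∈ V0 d then f ⟨(t • ξ, t), h⟩ else 0

/-- The Laplace–Beltrami operator `Δ₀` of the unit sphere: the Laplacian of the extension of `g`
that is homogeneous of degree zero, evaluated at a point `ξ` of the sphere. Only the values of `g`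
on the unit sphere are used. -/
def laplaceBeltrami {d : ℕ} (g : E d → ℝ) (ξ : E d) : ℝ :=
  (Laplacian.laplacian (fun x : E d => g (‖x‖⁻¹ • x)) : E d → ℝ) ξ

/-- The operator
`D_γ = t (1-t) d²/dt² + (d - 1 - (d+γ) t) d/dt + t⁻¹ Δ₀^{(ξ)}`
acting on a function on the conic surface written in the coordinates `(ξ, t)`; its value
at the point `(t ξ, t)`, for `ξ` in the unit sphere and `0 < t ≤ 1`. The derivatives in `t` are
derivatives within the interval `[0,1]` (one-sided at `t = 1`). -/
def diffOp {d : ℕ} (γ : ℝ) (f : V0 d → ℝ) (ξ : E d) (t : ℝ) : ℝ :=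
  t * (1 - t) * iteratedDerivWithin 2 (fun τ => polar f ξ τ) (Set.Icc 0 1) t
    + ((d : ℝ) - 1 - ((d : ℝ) + γ) * t) * derivWithin (fun τ => polar f ξ τ) (Set.Icc 0 1) t
    + t⁻¹ * laplaceBeltrami (fun η => polar f η t) ξ

/-- The space `H_m^{d,0}` of solid harmonics: homogeneous polynomials of degree `m` in `d`
variables that are annihilated by the Laplace operator. -/
def solidHarmonics (d m : ℕ) : Set (MvPolynomial (Fin d) ℝ) :=
  {Y | Y.IsHomogeneous m ∧ ∑ i, MvPolynomial.pderiv i (MvPolynomial.pderiv i Y) = 0}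

/-- The function `(x,t) ↦ p(t) Y(x)` on the conic surface. -/
def mulHarmonic {d : ℕ} (p : ℝ → ℝ) (Y : MvPolynomial (Fin d) ℝ) : V0 d → ℝ :=
  fun z => p z.1.2 * MvPolynomial.eval (fun i => z.1.1 i) Y

/-- The Jacobi polynomial `P_n^{(α,β)}` for arbitrary real parameters:
`P_n^{(α,β)}(x) = (1/n!) ∑_k binom(n,k) (n+α+β+1)_k (α+k+1)_{n-k} ((x-1)/2)^k`,
which is `((α+1)_n / n!) ₂F₁(-n, n+α+β+1; α+1; (1-x)/2)` with the denominators `(α+1)_k`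
cancelled. -/
def jacobiP (n : ℕ) (α β x : ℝ) : ℝ :=
  (n.factorial : ℝ)⁻¹ * ∑ k ∈ Finset.range (n + 1),
    (n.choose k : ℝ) * (ascPochhammer ℝ k).eval ((n : ℝ) + α + β + 1)
      * (ascPochhammer ℝ (n - k)).eval (α + (k : ℝ) + 1) * ((x - 1) / 2) ^ k

/-- Restrictions to the conic surface of polynomials in `(x,t)` of total degree at most `k`. -/
def conePoly (d k : ℕ) : Set (V0 d → ℝ) :=
  {f | ∃ q : MvPolynomial (Fin d ⊕ Unit) ℝ, q.totalDegree ≤ k ∧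
    ∀ z : V0 d, f z = MvPolynomial.eval (Sum.elim (fun i => z.1.1 i) (fun _ => z.1.2)) q}

/-- The inner product
`⟨f, g⟩_{β,γ} = ∫_{V₀} f g t^β (1-t)^γ dm`, where
`∫_{V₀} F dm = ∫₀¹ t^{d-1} ∫_{S^{d-1}} F(t ξ, t) dσ(ξ) dt` and `σ` is the surface measure.
The positive normalization constant in front is dropped: it does not affect orthogonality. -/
def coneInner {d : ℕ} (β γ : ℝ) (f g : V0 d → ℝ) : ℝ :=
  ∫ t in (0 : ℝ)..1, t ^ (d - 1) *
    (∫ ξ : Metric.sphere (0 : E d) 1,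
      polar f (ξ : E d) t * polar g (ξ : E d) t
        ∂((MeasureTheory.volume : MeasureTheory.Measure (E d)).toSphere))
    * (t ^ β * (1 - t) ^ γ)

/-- The space `V_n^d(w_{β,γ})` of orthogonal polynomials of degree `n` on the conic surface:
polynomials of degree at most `n` that are orthogonal to all polynomials of lower degree. -/
def orthPoly (d n : ℕ) (β γ : ℝ) : Set (V0 d → ℝ) :=
  {f | f ∈ conePoly d n ∧ ∀ k < n, ∀ g ∈ conePoly d k, coneInner β γ f g = 0}

/-- The space `U_n^d(w_{-1,-s})`: the linear span of `H_n^{d,0}`, of the products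
`P_j^{(2n-2j+d-2,-s)}(1-2t) H_{n-j}^{d,0}` for `1 ≤ j ≤ s-1` and of `(1-t)^s V_{n-s}^d(w_{-1,s})`.
Spaces with a negative index are zero, so only `j ≤ n` occur, and the last part
occurs only for `s ≤ n`. -/
def spaceU (d n s : ℕ) : Submodule ℝ (V0 d → ℝ) :=
  Submodule.span ℝ
    ({f | ∃ Y ∈ solidHarmonics d n, f = mulHarmonic (fun _ => 1) Y}
      ∪ {f | ∃ j : ℕ, 1 ≤ j ∧ j ≤ s - 1 ∧ j ≤ n ∧ ∃ Y ∈ solidHarmonics d (n - j),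
          f = mulHarmonic
            (fun t => jacobiP j (2 * (n : ℝ) - 2 * (j : ℝ) + (d : ℝ) - 2) (-(s : ℝ)) (1 - 2 * t)) Y}
      ∪ {f | s ≤ n ∧ ∃ g ∈ orthPoly d (n - s) (-1) (s : ℝ),
          f = fun z => (1 - z.1.2) ^ s * g z})

end ConicSurface

end

/-! The space `U_n` splits by spherical degree: it is the sum over `0 ≤ k ≤ n` of `q_k(t) H_k`, with
a single radial polynomial `q_k` for each `k` (`radialFactor`, `range_harmonicSum`). For `n - s < k
≤ n` the factor is the Jacobi polynomial in the definition of `U_n`, with `j = n - k` and `P_0 = 1`.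
For `k ≤ n - s` it is `(1-t)^s` times the orthogonal polynomial of degree `n - s - k` for the weight
`t^(2k+d-2) (1-t)^s`, because `exists_of_mem_orthPoly` splits `V_{n-s}` in the same way.

Eigenvalue equation: every `q_k` solves the Jacobi equation with parameters `(2k+d-2, -s)` and
eigenvalue `(n-k)(n+k+d-1-s)` (`jacobiOp_radialFactor`). On the cone `q_k(t) Y(x) = q_k(t) t^k
Y(ξ)`, and `Y(ξ)` is an eigenfunction of `Δ₀` with eigenvalue `-k(k+d-2)`. Conjugating `D_{-s}` by
`t^k` therefore turns the claim into that Jacobi equation (`diffOp_radialTerm`).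

Dimension: harmonics of different degrees are orthogonal on the sphere and no `q_k` is zero, so the
sum is direct (`injective_harmonicSum`) and the dimension is `∑ dim H_k`. This sum telescopes
because `dim H_k = dim P_k - dim P_{k-2}`, where `P_k` is the space of homogeneous polynomials.

Orthogonality on the sphere comes from integration by parts against `exp(-‖x‖²)` on all of `ℝ^d`:
for homogeneous polynomials the Gaussian integral is a positive multiple of the integral over the
sphere. -/

/-! ### Gaussian integrals of polynomials and integration over the unit sphere -/

noncomputable section

namespace ConicSurface

open MeasureTheory Set

/-- The Gaussian moment `∫ x^k exp(-x²) dx`. -/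
def gaussMoment (k : ℕ) : ℝ := ∫ x : ℝ, x ^ k * Real.exp (-x ^ 2)

lemma integrable_pow_mul_exp_neg_sq (k : ℕ) :
    Integrable fun x : ℝ => x ^ k * Real.exp (-x ^ 2) := by
  simpa using integrable_rpow_mul_exp_neg_mul_sq one_pos
    (s := (k : ℝ)) (by linarith [Nat.cast_nonneg (α := ℝ) k])

/-- The derivative of `x^k exp(-x²)` integrates to zero. At `k = 0` the truncated index `k - 1` is
harmless, since its coefficient vanishes. -/
lemma gaussMoment_succ (k : ℕ) : 2 * gaussMoment (k + 1) = k * gaussMoment (k - 1) := by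
  have hd : ∀ x : ℝ, HasDerivAt (fun x : ℝ => x ^ k * Real.exp (-x ^ 2))
      (k * (x ^ (k - 1) * Real.exp (-x ^ 2)) - 2 * (x ^ (k + 1) * Real.exp (-x ^ 2))) x := by
    intro x
    have h := (hasDerivAt_pow k x).mul ((hasDerivAt_pow 2 x).neg.exp)
    convert! h using 1
    simp only [Pi.neg_apply]
    push_cast
    ring
  have hi := ((integrable_pow_mul_exp_neg_sq (k - 1)).const_mul (k : ℝ)).sub
    ((integrable_pow_mul_exp_neg_sq (k + 1)).const_mul 2)
  have h0 := integral_eq_zero_of_hasDerivAt_of_integrable hd hi (integrable_pow_mul_exp_neg_sq k)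
  rw [integral_sub ((integrable_pow_mul_exp_neg_sq (k - 1)).const_mul (k : ℝ))
    ((integrable_pow_mul_exp_neg_sq (k + 1)).const_mul 2), integral_const_mul,
    integral_const_mul] at h0
  simp only [gaussMoment]
  linarith

lemma eval_monomial_mul_exp {d : ℕ} (a : Fin d →₀ ℕ) (c : ℝ) (x : Fin d → ℝ) :
    MvPolynomial.eval x (MvPolynomial.monomial a c) * Real.exp (-∑ i, x i ^ 2)
      = c * ∏ i, (x i ^ a i * Real.exp (-x i ^ 2)) := by
  rw [MvPolynomial.eval_monomial, Finset.prod_mul_distrib, ← Real.exp_sum,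
    Finset.sum_neg_distrib, Finsupp.prod_fintype _ _ (by simp), mul_assoc]

lemma integrable_eval_mul_exp {d : ℕ} (p : MvPolynomial (Fin d) ℝ) :
    Integrable fun x : Fin d → ℝ => MvPolynomial.eval x p * Real.exp (-∑ i, x i ^ 2) := by
  induction p using MvPolynomial.induction_on' with
  | monomial a c =>
    simp_rw [eval_monomial_mul_exp]
    exact (Integrable.fintype_prod (f := fun i (x : ℝ) => x ^ a i * Real.exp (-x ^ 2))
      fun i => integrable_pow_mul_exp_neg_sq (a i)).const_mul c
  | add p q hp hq =>
    simp only [map_add, add_mul]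
    exact hp.add hq

/-- The Gaussian integral `p ↦ ∫ p(x) exp(-‖x‖²) dx` of polynomials. -/
def gaussInt (d : ℕ) : MvPolynomial (Fin d) ℝ →ₗ[ℝ] ℝ where
  toFun p := ∫ x : Fin d → ℝ, MvPolynomial.eval x p * Real.exp (-∑ i, x i ^ 2)
  map_add' p q := by
    simp only [map_add, add_mul]
    exact integral_add (integrable_eval_mul_exp p) (integrable_eval_mul_exp q)
  map_smul' c p := by
    simp [MvPolynomial.smul_eval, mul_assoc, integral_const_mul]

lemma gaussInt_apply {d : ℕ} (p : MvPolynomial (Fin d) ℝ) :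
    gaussInt d p = ∫ x : Fin d → ℝ, MvPolynomial.eval x p * Real.exp (-∑ i, x i ^ 2) := rfl

lemma gaussInt_monomial {d : ℕ} (a : Fin d →₀ ℕ) (c : ℝ) :
    gaussInt d (MvPolynomial.monomial a c) = c * ∏ i, gaussMoment (a i) := by
  rw [gaussInt_apply]
  simp_rw [eval_monomial_mul_exp]
  rw [integral_const_mul, integral_fintype_prod_volume_eq_prod
    (fun i (x : ℝ) => x ^ a i * Real.exp (-x ^ 2))]
  rfl

/-- Integration by parts without boundary terms. On monomials only the `i`-th one-dimensional moment
changes. -/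
lemma gaussInt_pderiv {d : ℕ} (i : Fin d) (p : MvPolynomial (Fin d) ℝ) :
    gaussInt d (MvPolynomial.pderiv i p) = 2 * gaussInt d (MvPolynomial.X i * p) := by
  induction p using MvPolynomial.induction_on' with
  | monomial a c =>
    rw [MvPolynomial.pderiv_monomial, MvPolynomial.X, MvPolynomial.monomial_mul,
      gaussInt_monomial, gaussInt_monomial, ← Finset.mul_prod_erase _ _ (Finset.mem_univ i),
      ← Finset.mul_prod_erase Finset.univ (fun j => gaussMoment _) (Finset.mem_univ i)]
    have h1 : ∀ j ∈ Finset.univ.erase i,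
        gaussMoment ((a - Finsupp.single i 1 : Fin d →₀ ℕ) j) = gaussMoment (a j) := by
      intro j hj
      rw [Finsupp.tsub_apply, Finsupp.single_eq_of_ne (Finset.ne_of_mem_erase hj), Nat.sub_zero]
    have h2 : ∀ j ∈ Finset.univ.erase i,
        gaussMoment ((Finsupp.single i 1 + a : Fin d →₀ ℕ) j) = gaussMoment (a j) := by
      intro j hj
      rw [Finsupp.add_apply, Finsupp.single_eq_of_ne (Finset.ne_of_mem_erase hj), zero_add]
    rw [Finset.prod_congr rfl h1, Finset.prod_congr rfl h2]
    have := gaussMoment_succ (a i)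
    simp only [Finsupp.tsub_apply, Finsupp.single_eq_same, Finsupp.add_apply, add_comm 1]
    linear_combination (-c * ∏ x ∈ Finset.univ.erase i, gaussMoment (a x)) * this
  | add p q hp hq => simp [mul_add, hp, hq]

/-- The integral of a polynomial over the unit sphere. -/
def sphereInt (d : ℕ) : MvPolynomial (Fin d) ℝ →ₗ[ℝ] ℝ where
  toFun p := ∫ ξ : Metric.sphere (0 : E d) 1, MvPolynomial.eval (fun i => (ξ : E d) i) p
    ∂((volume : Measure (E d)).toSphere)
  map_add' p q := by
    simp only [map_add]
    refine integral_add ?_ ?_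
    · exact (Continuous.integrable_of_hasCompactSupport
        ((MvPolynomial.continuous_eval p).comp (by fun_prop)) (HasCompactSupport.of_compactSpace _))
    · exact (Continuous.integrable_of_hasCompactSupport
        ((MvPolynomial.continuous_eval q).comp (by fun_prop)) (HasCompactSupport.of_compactSpace _))
  map_smul' c p := by
    simp [MvPolynomial.smul_eval, integral_const_mul]

lemma sphereInt_apply {d : ℕ} (p : MvPolynomial (Fin d) ℝ) :
    sphereInt d p = ∫ ξ : Metric.sphere (0 : E d) 1,
      MvPolynomial.eval (fun i => (ξ : E d) i) p ∂((volume : Measure (E d)).toSphere) := rfl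

lemma eval_smul_of_isHomogeneous {d k : ℕ} {p : MvPolynomial (Fin d) ℝ} (hp : p.IsHomogeneous k)
    (r : ℝ) (x : Fin d → ℝ) :
    MvPolynomial.eval (fun i => r * x i) p = r ^ k * MvPolynomial.eval x p := by
  rw [MvPolynomial.eval_eq, MvPolynomial.eval_eq, Finset.mul_sum]
  refine Finset.sum_congr rfl fun a ha => ?_
  have hdeg : ∑ i, a i = k := by
    have := hp (MvPolynomial.mem_support_iff.mp ha)
    rw [Finsupp.weight_apply, Finsupp.sum_fintype _ _ (by simp)] at this
    simpa using this
  have : ∀ s : Finset (Fin d), ∏ i ∈ s, (r * x i) ^ a i = r ^ (∑ i ∈ s, a i) * ∏ i ∈ s, x i ^ a i := by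
    intro s
    rw [← Finset.prod_pow_eq_pow_sum, ← Finset.prod_mul_distrib]
    exact Finset.prod_congr rfl fun i _ => mul_pow _ _ _
  have hsup : ∑ i ∈ a.support, a i = k := by
    rw [← hdeg]
    exact Finset.sum_subset (Finset.subset_univ _) (by simp)
  rw [this, hsup]
  ring

/-- The radial factor in the Gaussian integral of a homogeneous polynomial of degree `k`. -/
def radialMoment (d k : ℕ) : ℝ := ∫ r in Ioi (0 : ℝ), r ^ (d - 1) * (r ^ k * Real.exp (-r ^ 2))

lemma radialMoment_pos (d k : ℕ) : 0 < radialMoment d k := by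
  have hint : IntegrableOn (fun r : ℝ => r ^ (d - 1) * (r ^ k * Real.exp (-r ^ 2))) (Ioi 0) := by
    simp_rw [← mul_assoc, ← pow_add]
    exact (integrable_pow_mul_exp_neg_sq _).integrableOn
  rw [radialMoment, setIntegral_pos_iff_support_of_nonneg_ae]
  · have : (Function.support fun r : ℝ => r ^ (d - 1) * (r ^ k * Real.exp (-r ^ 2))) ∩ Ioi 0
        = Ioi 0 := by
      refine inter_eq_right.mpr fun r hr => ?_
      have : (0 : ℝ) < r := hr
      exact (by positivity : 0 < r ^ (d - 1) * (r ^ k * Real.exp (-r ^ 2))).ne'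
    rw [this]
    simp
  · filter_upwards [ae_restrict_mem measurableSet_Ioi] with r hr
    have : (0 : ℝ) < r := hr
    exact (by positivity : 0 ≤ r ^ (d - 1) * (r ^ k * Real.exp (-r ^ 2)))
  · exact hint

/-- Polar coordinates: by homogeneity the integrand is a product of a function of `ξ` and a function
of `r`. -/
lemma gaussInt_eq_radialMoment_mul_sphereInt {d k : ℕ} (hd : 0 < d) {p : MvPolynomial (Fin d) ℝ}
    (hp : p.IsHomogeneous k) : gaussInt d p = radialMoment d k * sphereInt d p := by
  have : Nonempty (Fin d) := ⟨⟨0, hd⟩⟩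
  have : Nontrivial (E d) := inferInstance
  have h1 : gaussInt d p = ∫ x : E d, MvPolynomial.eval (fun i => x i) p * Real.exp (-‖x‖ ^ 2) := by
    rw [gaussInt_apply, ← (PiLp.volume_preserving_toLp (Fin d)).integral_comp
      (MeasurableEquiv.toLp 2 _).measurableEmbedding]
    simp [EuclideanSpace.norm_sq_eq]
  have hfin : Module.finrank ℝ (E d) = d := by simp
  set μ : Measure (E d) := volume
  calc gaussInt d p
      = ∫ x : E d, MvPolynomial.eval (fun i => x i) p * Real.exp (-‖x‖ ^ 2) ∂μ := h1
    _ = ∫ x : ({(0)}ᶜ : Set (E d)),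
          MvPolynomial.eval (fun i => x.1 i) p * Real.exp (-‖x.1‖ ^ 2) ∂(μ.comap (↑)) := by
      rw [integral_subtype_comap (measurableSet_singleton _).compl
        fun x : E d => MvPolynomial.eval (fun i => x i) p * Real.exp (-‖x‖ ^ 2),
        restrict_compl_singleton]
    _ = ∫ z : Metric.sphere (0 : E d) 1 × Ioi (0 : ℝ),
          MvPolynomial.eval (fun i => (z.1 : E d) i) p * ((z.2 : ℝ) ^ k * Real.exp (-(z.2 : ℝ) ^ 2))
          ∂μ.toSphere.prod (.volumeIoiPow (d - 1)) := by
      have hmp := μ.measurePreserving_homeomorphUnitSphereProd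
      rw [hfin] at hmp
      rw [← hmp.integral_comp (Homeomorph.measurableEmbedding _)]
      refine integral_congr_ae (Filter.Eventually.of_forall fun x => ?_)
      have hx : ‖x.1‖ ≠ 0 := norm_ne_zero_iff.mpr x.2
      have : (fun i => x.1 i) = fun i => ‖x.1‖ * (‖x.1‖⁻¹ • x.1) i := by
        ext i
        simp [hx]
      simp only [homeomorphUnitSphereProd_apply_snd_coe, homeomorphUnitSphereProd_apply_fst_coe]
      rw [this, eval_smul_of_isHomogeneous hp]
      simp only [PiLp.smul_apply, smul_eq_mul]
      have he : (‖x.1‖⁻¹ • x.1).ofLp = fun i => ‖x.1‖⁻¹ * x.1.ofLp i := rfl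
      rw [he]
      ring
    _ = (∫ ξ : Metric.sphere (0 : E d) 1, MvPolynomial.eval (fun i => (ξ : E d) i) p ∂μ.toSphere)
        * ∫ r : Ioi (0 : ℝ), ((r : ℝ) ^ k * Real.exp (-(r : ℝ) ^ 2)) ∂.volumeIoiPow (d - 1) :=
      integral_prod_mul (fun ξ : Metric.sphere (0 : E d) 1 => MvPolynomial.eval (fun i => (ξ : E d) i) p)
        (fun r : Ioi (0 : ℝ) => ((r : ℝ) ^ k * Real.exp (-(r : ℝ) ^ 2)))
    _ = radialMoment d k * sphereInt d p := by
      rw [mul_comm]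
      congr 1
      simp only [Measure.volumeIoiPow, ENNReal.ofReal]
      rw [integral_withDensity_eq_integral_smul,
        integral_subtype_comap measurableSet_Ioi fun a : ℝ =>
          Real.toNNReal (a ^ (d - 1)) • (a ^ k * Real.exp (-a ^ 2)),
        radialMoment, setIntegral_congr_fun measurableSet_Ioi fun x hx => ?_]
      · rw [NNReal.smul_def, Real.coe_toNNReal _ (pow_nonneg hx.out.le _), smul_eq_mul]
      · exact (measurable_subtype_coe.pow_const _).real_toNNReal

lemma eq_zero_of_sphereInt_mul_self {d k : ℕ} (hd : 0 < d) {p : MvPolynomial (Fin d) ℝ}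
    (hp : p.IsHomogeneous k) (h : sphereInt d (p * p) = 0) : p = 0 := by
  have hg : gaussInt d (p * p) = 0 := by
    rw [gaussInt_eq_radialMoment_mul_sphereInt hd (hp.mul hp), h, mul_zero]
  rw [gaussInt_apply, integral_eq_zero_iff_of_nonneg] at hg
  · have hc : Continuous fun x : Fin d → ℝ =>
        MvPolynomial.eval x (p * p) * Real.exp (-∑ i, x i ^ 2) :=
      (MvPolynomial.continuous_eval _).mul (by fun_prop)
    have := (hc.ae_eq_iff_eq volume continuous_const (g := 0)).mp hg
    refine MvPolynomial.funext fun x => ?_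
    have hx := congrFun this x
    simpa [Real.exp_ne_zero] using hx
  · intro x
    simp only [map_mul, Pi.zero_apply]
    positivity [mul_self_nonneg (MvPolynomial.eval x p)]
  · exact integrable_eval_mul_exp _

/-- The Laplace operator on polynomials. -/
def polyLaplacian (d : ℕ) : MvPolynomial (Fin d) ℝ →ₗ[ℝ] MvPolynomial (Fin d) ℝ :=
  ∑ i, (MvPolynomial.pderiv i).toLinearMap ∘ₗ (MvPolynomial.pderiv i).toLinearMap

lemma polyLaplacian_apply {d : ℕ} (p : MvPolynomial (Fin d) ℝ) :
    polyLaplacian d p = ∑ i, MvPolynomial.pderiv i (MvPolynomial.pderiv i p) := by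
  simp [polyLaplacian]

/-- Since `Δq = 0`, the left integrand is the divergence of `p ∇q`. Gaussian integration by parts
turns it into `2 p (x · ∇q)`, and Euler's identity gives `x · ∇q = k q`. -/
lemma gaussInt_grad_mul_grad {d k : ℕ} {p q : MvPolynomial (Fin d) ℝ} (hq : q.IsHomogeneous k)
    (hq0 : polyLaplacian d q = 0) :
    gaussInt d (∑ i, MvPolynomial.pderiv i p * MvPolynomial.pderiv i q)
      = 2 * k * gaussInt d (p * q) := by
  have h1 : ∑ i, gaussInt d (MvPolynomial.pderiv i (p * MvPolynomial.pderiv i q))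
      = gaussInt d (∑ i, MvPolynomial.pderiv i p * MvPolynomial.pderiv i q) := by
    rw [← map_sum]
    simp only [Derivation.leibniz, smul_eq_mul, Finset.sum_add_distrib, ← Finset.mul_sum]
    rw [← polyLaplacian_apply, hq0, mul_zero, zero_add]
    simp only [mul_comm]
  rw [← h1]
  simp_rw [gaussInt_pderiv]
  rw [← Finset.mul_sum, ← map_sum, mul_assoc]
  congr 1
  have : ∑ i, MvPolynomial.X i * (p * MvPolynomial.pderiv i q) = (k : ℝ) • (p * q) := by
    have he := hq.sum_X_mul_pderiv
    calc _ = p * ∑ i, MvPolynomial.X i * MvPolynomial.pderiv i q := by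
          rw [Finset.mul_sum]
          exact Finset.sum_congr rfl fun i _ => by ring
      _ = _ := by rw [he, mul_smul_comm, Nat.cast_smul_eq_nsmul]
  rw [this, map_smul, smul_eq_mul]

/-- The integral of `∇p · ∇q` is symmetric in `p` and `q`, so it equals both `2k ∫ pq` and `2l ∫
pq`. -/
lemma sphereInt_mul_eq_zero {d k l : ℕ} (hd : 0 < d) (hkl : k ≠ l) {p q : MvPolynomial (Fin d) ℝ}
    (hp : p ∈ solidHarmonics d k) (hq : q ∈ solidHarmonics d l) : sphereInt d (p * q) = 0 := by
  have h1 := gaussInt_grad_mul_grad (p := p) hq.1 (by rw [polyLaplacian_apply]; exact hq.2)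
  have h2 := gaussInt_grad_mul_grad (p := q) hp.1 (by rw [polyLaplacian_apply]; exact hp.2)
  simp_rw [mul_comm (MvPolynomial.pderiv _ q), mul_comm q p] at h2
  have hkl' : (k : ℝ) - l ≠ 0 := sub_ne_zero.mpr (by exact_mod_cast hkl)
  have h3 : ((k : ℝ) - l) * gaussInt d (p * q) = 0 := by linarith
  rw [gaussInt_eq_radialMoment_mul_sphereInt hd (hp.1.mul hq.1)] at h3
  simpa [hkl', (radialMoment_pos d (k + l)).ne'] using h3

end ConicSurface

end

/-! ### Decomposition of homogeneous polynomials into solid harmonics -/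

noncomputable section

namespace ConicSurface

open MeasureTheory Set

/-- The polynomial `‖x‖²`. -/
def normSqPoly (d : ℕ) : MvPolynomial (Fin d) ℝ := ∑ i, MvPolynomial.X i ^ 2

lemma normSqPoly_isHomogeneous (d : ℕ) : (normSqPoly d).IsHomogeneous 2 :=
  MvPolynomial.IsHomogeneous.sum _ _ _ fun i _ => by
    simpa using (MvPolynomial.isHomogeneous_X ℝ i).pow 2

lemma eval_normSqPoly {d : ℕ} (x : E d) :
    MvPolynomial.eval (fun i => x i) (normSqPoly d) = ‖x‖ ^ 2 := by
  simp [normSqPoly, EuclideanSpace.norm_sq_eq]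

lemma sphereInt_normSqPoly_mul {d : ℕ} (p : MvPolynomial (Fin d) ℝ) :
    sphereInt d (normSqPoly d * p) = sphereInt d p := by
  simp only [sphereInt_apply, map_mul, eval_normSqPoly]
  refine integral_congr_ae (Filter.Eventually.of_forall fun ξ => ?_)
  simp

/-- The space of solid harmonics of degree `k` as a subspace. -/
def harmonicSubmodule (d k : ℕ) : Submodule ℝ (MvPolynomial (Fin d) ℝ) :=
  MvPolynomial.homogeneousSubmodule (Fin d) ℝ k ⊓ LinearMap.ker (polyLaplacian d)

lemma mem_harmonicSubmodule {d k : ℕ} {p : MvPolynomial (Fin d) ℝ} :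
    p ∈ harmonicSubmodule d k ↔ p ∈ solidHarmonics d k := by
  simp [harmonicSubmodule, solidHarmonics, polyLaplacian_apply]

instance finite_homogeneousSubmodule (d k : ℕ) :
    Module.Finite ℝ (MvPolynomial.homogeneousSubmodule (Fin d) ℝ k) :=
  Module.Finite.iff_fg.mpr (MvPolynomial.homogeneousSubmodule_fg (Fin d) ℝ k)

instance finite_harmonicSubmodule (d k : ℕ) : Module.Finite ℝ (harmonicSubmodule d k) :=
  Submodule.finiteDimensional_of_le inf_le_left

lemma polyLaplacian_isHomogeneous {d k : ℕ} {p : MvPolynomial (Fin d) ℝ}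
    (hp : p.IsHomogeneous (k + 2)) : (polyLaplacian d p).IsHomogeneous k := by
  rw [polyLaplacian_apply]
  exact MvPolynomial.IsHomogeneous.sum _ _ _ fun i _ => hp.pderiv.pderiv

lemma polyLaplacian_eq_zero_of_lt_two {d k : ℕ} (hk : k < 2) {p : MvPolynomial (Fin d) ℝ}
    (hp : p.IsHomogeneous k) : polyLaplacian d p = 0 := by
  rw [polyLaplacian_apply]
  refine Finset.sum_eq_zero fun i _ => ?_
  have h0 : (MvPolynomial.pderiv i p).IsHomogeneous 0 := by
    have := hp.pderiv (i := i)
    rwa [show k - 1 = 0 by omega] at this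
  rw [← MvPolynomial.totalDegree_zero_iff_isHomogeneous,
    MvPolynomial.totalDegree_eq_zero_iff_eq_C] at h0
  rw [h0, MvPolynomial.pderiv_C]

/-- The Laplace operator from homogeneous polynomials of degree `k + 2` to degree `k`. -/
def lapHom (d k : ℕ) : MvPolynomial.homogeneousSubmodule (Fin d) ℝ (k + 2) →ₗ[ℝ]
    MvPolynomial.homogeneousSubmodule (Fin d) ℝ k :=
  (polyLaplacian d).restrict fun _ hp => polyLaplacian_isHomogeneous hp

/-- Multiplication by `‖x‖²` from homogeneous polynomials of degree `k` to degree `k + 2`. -/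
def mulNormSqHom (d k : ℕ) : MvPolynomial.homogeneousSubmodule (Fin d) ℝ k →ₗ[ℝ]
    MvPolynomial.homogeneousSubmodule (Fin d) ℝ (k + 2) :=
  (LinearMap.mulLeft ℝ (normSqPoly d)).restrict fun p hp => by
    have := (normSqPoly_isHomogeneous d).mul (show p.IsHomogeneous k from hp)
    rwa [add_comm] at this

/-- Solid harmonics of degree greater than `k` are orthogonal on the sphere to homogeneous
polynomials of degree `k`. -/
def HarmonicOrth (d k : ℕ) : Prop :=
  ∀ q : MvPolynomial (Fin d) ℝ, q.IsHomogeneous k → ∀ K, k < K → ∀ Y ∈ solidHarmonics d K,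
    sphereInt d (Y * q) = 0

/-- If `‖x‖² q` is harmonic, it is orthogonal to `q` on the sphere, where `‖x‖² = 1`; hence `∫ q² =
0` and `q = 0`. Injectivity suffices, as source and target are the same finite-dimensional space. -/
lemma HarmonicOrth.bijective {d k : ℕ} (hd : 0 < d) (h : HarmonicOrth d k) :
    Function.Bijective (lapHom d k ∘ₗ mulNormSqHom d k) := by
  have hinj : Function.Injective (lapHom d k ∘ₗ mulNormSqHom d k) := by
    rw [← LinearMap.ker_eq_bot, LinearMap.ker_eq_bot']
    rintro ⟨q, hq⟩ h0
    have h1 : polyLaplacian d (normSqPoly d * q) = 0 := congrArg Subtype.val h0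
    have h2 : normSqPoly d * q ∈ solidHarmonics d (k + 2) :=
      mem_harmonicSubmodule.mp ⟨(mulNormSqHom d k ⟨q, hq⟩).2, h1⟩
    have h3 := h q hq (k + 2) (by omega) _ h2
    rw [mul_assoc, sphereInt_normSqPoly_mul] at h3
    exact Subtype.ext (eq_zero_of_sphereInt_mul_self hd hq h3)
  exact ⟨hinj, LinearMap.surjective_of_injective hinj⟩

lemma HarmonicOrth.exists_decomp {d k : ℕ} (hd : 0 < d) (h : HarmonicOrth d k)
    {p : MvPolynomial (Fin d) ℝ} (hp : p.IsHomogeneous (k + 2)) :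
    ∃ Y ∈ solidHarmonics d (k + 2), ∃ q : MvPolynomial (Fin d) ℝ, q.IsHomogeneous k ∧
      p = Y + normSqPoly d * q := by
  obtain ⟨q, hq⟩ := (h.bijective hd).2 (lapHom d k ⟨p, hp⟩)
  have hq' : polyLaplacian d (normSqPoly d * q) = polyLaplacian d p := congrArg Subtype.val hq
  refine ⟨p - normSqPoly d * q, mem_harmonicSubmodule.mp ⟨?_, ?_⟩, q, q.2, by ring⟩
  · exact Submodule.sub_mem _ hp (mulNormSqHom d k q).2
  · change polyLaplacian d (p - normSqPoly d * q) = 0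
    rw [map_sub, hq', sub_self]

/-- Orthogonality in degree `j` yields the decomposition in degree `j + 2`. That reduces degree `j +
2` to distinct harmonic degrees and to degree `j`, so the two facts are proved in one induction. -/
lemma harmonicOrth {d : ℕ} (hd : 0 < d) (k : ℕ) : HarmonicOrth d k := by
  induction k using Nat.strong_induction_on with
  | _ k ih =>
    intro q hq K hK Y hY
    rcases lt_or_ge k 2 with hk | hk
    · exact sphereInt_mul_eq_zero hd hK.ne' hY
        (mem_harmonicSubmodule.mp ⟨hq, polyLaplacian_eq_zero_of_lt_two hk hq⟩)
    · obtain ⟨j, rfl⟩ := Nat.exists_eq_add_of_le' hk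
      obtain ⟨Z, hZ, q', hq', rfl⟩ := (ih j (by omega)).exists_decomp hd hq
      rw [mul_add, map_add, sphereInt_mul_eq_zero hd hK.ne' hY hZ, mul_left_comm,
        sphereInt_normSqPoly_mul, ih j (by omega) q' hq' K (by omega) Y hY, add_zero]

lemma finrank_homogeneousSubmodule (d k : ℕ) :
    Module.finrank ℝ (MvPolynomial.homogeneousSubmodule (Fin d) ℝ k) = (d + k - 1).choose k := by
  have h : MvPolynomial.homogeneousSubmodule (Fin d) ℝ k
      = MvPolynomial.restrictSupport ℝ {a : Fin d →₀ ℕ | a.degree = k} :=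
    MvPolynomial.homogeneousSubmodule_eq_finsupp_supported (Fin d) ℝ k
  have hs : {a : Fin d →₀ ℕ | a.degree = k}
      = ((Finset.univ : Finset (Fin d)).finsuppAntidiag k : Set (Fin d →₀ ℕ)) := by
    ext a
    simp [Finset.mem_finsuppAntidiag, Finsupp.degree_eq_sum]
  rw [h, hs, Module.finrank_eq_nat_card_basis (MvPolynomial.basisRestrictSupport ℝ _)]
  rw [Nat.card_coe_set_eq, Set.ncard_coe_finset, Finset.card_finsuppAntidiag_nat_eq_choose]
  simp

lemma finrank_harmonicSubmodule_of_lt_two {d k : ℕ} (hk : k < 2) :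
    Module.finrank ℝ (harmonicSubmodule d k) = (d + k - 1).choose k := by
  rw [← finrank_homogeneousSubmodule]
  have : harmonicSubmodule d k = MvPolynomial.homogeneousSubmodule (Fin d) ℝ k :=
    inf_eq_left.mpr fun p hp => polyLaplacian_eq_zero_of_lt_two hk hp
  rw [this]

/-- Rank-nullity for the Laplacian from degree `k + 2` to degree `k`, which is surjective because it
already is on multiples of `‖x‖²`. -/
lemma finrank_harmonicSubmodule_add {d : ℕ} (hd : 0 < d) (k : ℕ) :
    Module.finrank ℝ (harmonicSubmodule d (k + 2)) + (d + k - 1).choose k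
      = (d + (k + 2) - 1).choose (k + 2) := by
  rw [← finrank_homogeneousSubmodule, ← finrank_homogeneousSubmodule]
  have hsurj : Function.Surjective (lapHom d k) := fun q => by
    obtain ⟨p, hp⟩ := ((harmonicOrth hd k).bijective hd).2 q
    exact ⟨mulNormSqHom d k p, hp⟩
  have hker : (LinearMap.ker (lapHom d k)).map (Submodule.subtype _)
      = harmonicSubmodule d (k + 2) := by
    ext p
    constructor
    · rintro ⟨⟨q, hq⟩, h0, rfl⟩
      exact ⟨hq, congrArg Subtype.val h0⟩
    · rintro ⟨hp, h0⟩
      exact ⟨⟨p, hp⟩, Subtype.ext h0, rfl⟩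
  have h := (lapHom d k).finrank_range_add_finrank_ker
  rw [LinearMap.range_eq_top.mpr hsurj, finrank_top, ← Submodule.finrank_map_subtype_eq, hker] at h
  omega

/-- Telescoping by steps of two leaves `dim P_n + dim P_{n-1}`. -/
lemma sum_finrank_harmonicSubmodule {d : ℕ} (hd : 2 ≤ d) (n : ℕ) :
    ∑ k ∈ Finset.range (n + 1), Module.finrank ℝ (harmonicSubmodule d k)
      = (n + d - 1).choose (d - 1) + (n + d - 2).choose (d - 1) := by
  obtain ⟨e, rfl⟩ := Nat.exists_eq_add_of_le' hd
  induction n using Nat.strong_induction_on with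
  | _ n ih =>
    rcases n with _ | _ | n
    · simp [finrank_harmonicSubmodule_of_lt_two]
    · simp only [zero_add, Nat.reduceAdd, Finset.sum_range_succ, Finset.range_zero,
        Finset.sum_empty]
      rw [finrank_harmonicSubmodule_of_lt_two (by norm_num),
        finrank_harmonicSubmodule_of_lt_two (by norm_num),
        show 1 + (e + 2) - 1 = (e + 1) + 1 by omega, show e + 2 - 1 = e + 1 by omega,
        show 1 + (e + 2) - 2 = e + 1 by omega, show e + 2 + 1 - 1 = (e + 1) + 1 by omega]
      simp [Nat.choose_succ_self_right]
      omega
    · rw [Finset.sum_range_succ, ih (n + 1) (by omega)]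
      have h := finrank_harmonicSubmodule_add (d := e + 2) (by omega) n
      have h1 : (e + 2 + n - 1).choose n = (n + 1 + (e + 2) - 2).choose (e + 2 - 1) := by
        rw [show e + 2 + n - 1 = n + (e + 1) by omega,
          show n + 1 + (e + 2) - 2 = n + (e + 1) by omega, show e + 2 - 1 = e + 1 by omega]
        exact Nat.choose_symm_add
      have h2 : (e + 2 + (n + 2) - 1).choose (n + 2)
          = (n + 2 + (e + 2) - 1).choose (e + 2 - 1) := by
        rw [show e + 2 + (n + 2) - 1 = (n + 2) + (e + 1) by omega,
          show n + 2 + (e + 2) - 1 = (n + 2) + (e + 1) by omega, show e + 2 - 1 = e + 1 by omega]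
        exact Nat.choose_symm_add
      rw [h1, h2] at h
      have h3 : (n + 1 + (e + 2) - 1) = n + 2 + (e + 2) - 2 := by omega
      rw [h3, show n + 1 + 1 = n + 2 from rfl]
      omega

end ConicSurface

end

/-! ### The Jacobi differential operator on polynomials in one variable -/

noncomputable section

namespace ConicSurface

open MeasureTheory Set Polynomial

/-- The operator `t (1-t) p'' + (α + 1 - (α + β + 2) t) p'` on polynomials. -/
def jacobiOp (α β : ℝ) (p : ℝ[X]) : ℝ[X] :=
  X * (1 - X) * derivative (derivative p) + (C (α + 1) - C (α + β + 2) * X) * derivative p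

lemma coeff_jacobiOp (α β : ℝ) (p : ℝ[X]) (k : ℕ) :
    (jacobiOp α β p).coeff k
      = (k + 1) * (k + α + 1) * p.coeff (k + 1) - k * (k + α + β + 1) * p.coeff k := by
  have h : jacobiOp α β p = X * derivative (derivative p) - X * (X * derivative (derivative p))
      + C (α + 1) * derivative p - C (α + β + 2) * (X * derivative p) := by
    rw [jacobiOp]
    ring
  rw [h]
  rcases k with _ | _ | k <;>
  · simp only [coeff_add, coeff_sub, coeff_C_mul, coeff_X_mul, coeff_X_mul_zero, coeff_derivative]
    push_cast
    ring

/-- `t ↦ P_j^{(α,β)}(1 - 2 t)` as a polynomial. -/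
def jacobiPoly (j : ℕ) (α β : ℝ) : ℝ[X] :=
  C (j.factorial : ℝ)⁻¹ * ∑ k ∈ Finset.range (j + 1),
    C ((-1) ^ k * ((j.choose k : ℝ) * (ascPochhammer ℝ k).eval ((j : ℝ) + α + β + 1)
      * (ascPochhammer ℝ (j - k)).eval (α + (k : ℝ) + 1))) * X ^ k

lemma eval_jacobiPoly (j : ℕ) (α β t : ℝ) :
    (jacobiPoly j α β).eval t = jacobiP j α β (1 - 2 * t) := by
  simp only [jacobiPoly, jacobiP, eval_mul, eval_C, eval_finsetSum, eval_pow, eval_X]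
  congr 1
  refine Finset.sum_congr rfl fun k _ => ?_
  rw [show (1 - 2 * t - 1) / 2 = -1 * t by ring, mul_pow]
  ring

lemma coeff_jacobiPoly (j : ℕ) (α β : ℝ) (k : ℕ) :
    (jacobiPoly j α β).coeff k = (j.factorial : ℝ)⁻¹ * ((-1) ^ k *
      ((j.choose k : ℝ) * (ascPochhammer ℝ k).eval ((j : ℝ) + α + β + 1)
      * (ascPochhammer ℝ (j - k)).eval (α + (k : ℝ) + 1))) := by
  simp only [jacobiPoly, coeff_C_mul, finsetSum_coeff, coeff_X_pow]
  rcases lt_or_ge k (j + 1) with hk | hk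
  · simp [hk]
  · rw [Finset.sum_eq_zero, Nat.choose_eq_zero_of_lt (by omega)]
    · simp
    · intro i hi
      rw [Finset.mem_range] at hi
      simp [show k ≠ i by omega]

/-- The hypergeometric two-term recurrence for the coefficients. Clearing the denominators `(α+1)_k`
makes it valid for all real parameters. -/
lemma jacobiOp_jacobiPoly (j : ℕ) (α β : ℝ) :
    jacobiOp α β (jacobiPoly j α β) + C (j * (j + α + β + 1)) * jacobiPoly j α β = 0 := by
  ext k
  rw [coeff_add, coeff_C_mul, coeff_jacobiOp, coeff_zero, coeff_jacobiPoly, coeff_jacobiPoly]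
  rcases lt_trichotomy k j with hk | rfl | hk
  · obtain ⟨m, rfl⟩ := Nat.exists_eq_add_of_lt hk
    -- With `j = k + m + 1` this is `(k+1) binom(j,k+1) = (j-k) binom(j,k)`; the Pochhammer factors
    -- account for the rest of the recurrence.
    have h1 : (((k + m + 1).choose (k + 1) : ℕ) : ℝ) * (k + 1)
        = ((k + m + 1).choose k : ℕ) * (m + 1) := by
      have := Nat.choose_succ_right_eq (k + m + 1) k
      rw [show k + m + 1 - k = m + 1 by omega] at this
      exact_mod_cast this
    rw [show k + m + 1 - (k + 1) = m by omega, show k + m + 1 - k = m + 1 by omega,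
      ascPochhammer_succ_eval, ascPochhammer_succ_left]
    simp only [eval_mul, eval_X, eval_comp, eval_add, eval_one]
    push_cast
    rw [show α + ((k : ℝ) + 1) + 1 = α + k + 1 + 1 by ring, pow_succ]
    generalize (ascPochhammer ℝ k).eval _ = A
    generalize (ascPochhammer ℝ m).eval _ = B
    linear_combination (-(((k + m + 1).factorial : ℝ)⁻¹ * (-1) ^ k * A * B * (k + α + 1)
      * (k + m + 1 + α + β + 1 + k))) * h1
  · rw [Nat.choose_eq_zero_of_lt (Nat.lt_succ_self k)]
    push_cast
    ring
  · rw [Nat.choose_eq_zero_of_lt hk, Nat.choose_eq_zero_of_lt (by omega : j < k + 1)]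
    push_cast
    ring

/-- The coefficient to look at is the constant one, `(α+1)_j / j! > 0`; the leading one vanishes
under a degree reduction. -/
lemma jacobiPoly_ne_zero (j : ℕ) {α : ℝ} (hα : -1 < α) (β : ℝ) : jacobiPoly j α β ≠ 0 := by
  intro h
  have h0 := coeff_jacobiPoly j α β 0
  rw [h, coeff_zero] at h0
  have h1 : 0 < (ascPochhammer ℝ j).eval (α + 1) := ascPochhammer_pos j _ (by linarith)
  simp [Nat.factorial_ne_zero, h1.ne'] at h0

/-- The exponents of the Jacobi equation at `t = 1` are `0` and `-β`. For `β = -s`, splitting off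
`(1-t)^s` changes the parameter to `s` and shifts the eigenvalue by `s(α+1)`. -/
lemma jacobiOp_one_sub_pow_mul {α lam : ℝ} {s : ℕ} (hs : 2 ≤ s) {p : ℝ[X]}
    (h : jacobiOp α s p + C lam * p = 0) :
    jacobiOp α (-s) ((1 - X) ^ s * p) + C (lam + s * (α + 1)) * ((1 - X) ^ s * p) = 0 := by
  obtain ⟨r, rfl⟩ := Nat.exists_eq_add_of_le' hs
  simp only [jacobiOp] at h ⊢
  simp only [derivative_mul, derivative_pow, derivative_sub, derivative_one, derivative_X,
    derivative_zero, map_add, map_mul, map_neg, map_natCast, C_1, derivative_natCast,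
    Nat.add_sub_cancel, show r + 2 - 1 = r + 1 by omega, map_ofNat] at h ⊢
  push_cast at h ⊢
  linear_combination ((1 - X) ^ (r + 2)) * h

/-- Integration of polynomials over `[0,1]` against `t^a (1-t)^s`. -/
def jacobiInt (a s : ℕ) : ℝ[X] →ₗ[ℝ] ℝ where
  toFun p := ∫ t in (0 : ℝ)..1, p.eval t * (t ^ a * (1 - t) ^ s)
  map_add' p q := by
    simp only [eval_add, add_mul]
    exact intervalIntegral.integral_add (by apply Continuous.intervalIntegrable; fun_prop)
      (by apply Continuous.intervalIntegrable; fun_prop)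
  map_smul' c p := by
    simp [mul_assoc]

lemma jacobiInt_apply (a s : ℕ) (p : ℝ[X]) :
    jacobiInt a s p = ∫ t in (0 : ℝ)..1, p.eval t * (t ^ a * (1 - t) ^ s) := rfl

lemma jacobiInt_mul_self_ne_zero (a s : ℕ) {p : ℝ[X]} (hp : p ≠ 0) :
    jacobiInt a s (p * p) ≠ 0 := by
  obtain ⟨c, hc, hpc⟩ : ∃ c ∈ Ioo (0 : ℝ) 1, p.eval c ≠ 0 := by
    by_contra! hcon
    exact hp (eq_zero_of_infinite_isRoot p ((Ioo_infinite one_pos).mono hcon))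
  refine (intervalIntegral.integral_pos one_pos (by fun_prop) (fun t ht => ?_)
    ⟨c, Ioo_subset_Icc_self hc, ?_⟩).ne'
  · have h0 : 0 ≤ t := ht.1.le
    have h1 : 0 ≤ 1 - t := sub_nonneg.mpr ht.2
    rw [eval_mul]
    exact mul_nonneg (mul_self_nonneg _) (by positivity)
  · have h0 : 0 < c := hc.1
    have h1 : 0 < 1 - c := sub_pos.mpr hc.2
    rw [eval_mul]
    exact mul_pos (mul_self_pos.mpr hpc) (by positivity)

/-- Self-adjointness of the Sturm–Liouville operator. The boundary term `F` is the Wronskian times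
`t^(a+1) (1-t)^(s+1)`, which vanishes at both endpoints. -/
lemma jacobiInt_jacobiOp_mul (a s : ℕ) (p q : ℝ[X]) :
    jacobiInt a s (jacobiOp a s p * q) = jacobiInt a s (p * jacobiOp a s q) := by
  set F : ℝ[X] := X ^ (a + 1) * (1 - X) ^ (s + 1) * (derivative p * q - p * derivative q) with hF
  have hd : derivative F = (jacobiOp a s p * q - p * jacobiOp a s q) * (X ^ a * (1 - X) ^ s) := by
    simp only [hF, jacobiOp, derivative_mul, derivative_pow, derivative_sub, derivative_one,
      derivative_X, map_add, C_1, map_natCast, Nat.add_sub_cancel, map_ofNat]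
    push_cast
    ring
  have h := intervalIntegral.integral_eq_sub_of_hasDerivAt (a := 0) (b := 1)
    (fun t _ => F.hasDerivAt t) (by apply Continuous.intervalIntegrable; fun_prop)
  rw [hd] at h
  have h2 : jacobiInt a s (jacobiOp a s p * q - p * jacobiOp a s q) = 0 := by
    rw [jacobiInt_apply]
    simpa [hF] using h
  rwa [map_sub, sub_eq_zero] at h2

/-- `p` has degree at most `N` and is orthogonal to all polynomials of smaller degree with respect
to the weight `t^a (1-t)^s` on `[0,1]`. -/
def IsJacobiOrth (a s N : ℕ) (p : ℝ[X]) : Prop :=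
  p.natDegree ≤ N ∧ ∀ i < N, jacobiInt a s (p * X ^ i) = 0

lemma jacobiInt_mul_eq_zero {a s N : ℕ} {p : ℝ[X]}
    (hp : ∀ i < N, jacobiInt a s (p * X ^ i) = 0) {q : ℝ[X]} (hq : ∀ i, N ≤ i → q.coeff i = 0) :
    jacobiInt a s (p * q) = 0 := by
  rw [q.as_sum_support_C_mul_X_pow, Finset.mul_sum, map_sum]
  refine Finset.sum_eq_zero fun i hi => ?_
  have hi' : i < N := by
    by_contra! hcon
    exact mem_support_iff.mp hi (hq i hcon)
  rw [mul_left_comm, ← smul_eq_C_mul, map_smul, hp i hi', smul_zero]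

/-- Without a term of degree `N`, `p` is one of the polynomials to which it is orthogonal. -/
lemma IsJacobiOrth.eq_zero {a s N : ℕ} {p : ℝ[X]} (hp : IsJacobiOrth a s N p)
    (h0 : p.coeff N = 0) : p = 0 := by
  by_contra hne
  refine jacobiInt_mul_self_ne_zero a s hne (jacobiInt_mul_eq_zero hp.2 fun i hi => ?_)
  rcases hi.eq_or_lt with rfl | hi
  · exact h0
  · exact coeff_eq_zero_of_natDegree_lt (hp.1.trans_lt hi)

lemma IsJacobiOrth.sub {a s N : ℕ} {p q : ℝ[X]} (hp : IsJacobiOrth a s N p)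
    (hq : IsJacobiOrth a s N q) : IsJacobiOrth a s N (p - q) :=
  ⟨(natDegree_sub_le_of_le hp.1 hq.1).trans (by simp), fun i hi => by
    rw [sub_mul, map_sub, hp.2 i hi, hq.2 i hi, sub_zero]⟩

lemma IsJacobiOrth.C_mul {a s N : ℕ} {p : ℝ[X]} (hp : IsJacobiOrth a s N p) (c : ℝ) :
    IsJacobiOrth a s N (C c * p) :=
  ⟨(natDegree_C_mul_le c p).trans hp.1, fun i hi => by
    rw [mul_assoc, ← smul_eq_C_mul, map_smul, hp.2 i hi, smul_zero]⟩

lemma IsJacobiOrth.eq_C_mul {a s N : ℕ} {p q : ℝ[X]} (hp : IsJacobiOrth a s N p)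
    (hq : IsJacobiOrth a s N q) (h1 : p.coeff N = 1) : q = C (q.coeff N) * p := by
  have := (hq.sub (hp.C_mul (q.coeff N))).eq_zero (by simp [h1])
  exact sub_eq_zero.mp this

/-- The operator is self-adjoint and does not raise degrees, so the left side is again orthogonal to
lower degrees. The eigenvalue is chosen to cancel its coefficient of `t^N`. -/
lemma IsJacobiOrth.jacobiOp_add {a s N : ℕ} {p : ℝ[X]} (hp : IsJacobiOrth a s N p) :
    jacobiOp a s p + C (N * (N + a + s + 1) : ℝ) * p = 0 := by
  have hcoeff : ∀ i, (jacobiOp a s p + C (N * (N + a + s + 1) : ℝ) * p).coeff i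
      = (i + 1) * (i + a + 1) * p.coeff (i + 1) - i * (i + a + s + 1) * p.coeff i
        + N * (N + a + s + 1) * p.coeff i := fun i => by
    rw [coeff_add, coeff_jacobiOp, coeff_C_mul]
  have hN : ∀ i, N < i → p.coeff i = 0 := fun i hi =>
    coeff_eq_zero_of_natDegree_lt (hp.1.trans_lt hi)
  refine IsJacobiOrth.eq_zero (a := a) (s := s) (N := N) ⟨?_, fun i hi => ?_⟩ ?_
  · rw [natDegree_le_iff_coeff_eq_zero]
    intro i hi
    rw [hcoeff, hN i hi, hN (i + 1) (by omega)]
    ring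
  · rw [add_mul, map_add, jacobiInt_jacobiOp_mul, mul_assoc, ← smul_eq_C_mul, map_smul, hp.2 i hi,
      smul_zero, add_zero]
    refine jacobiInt_mul_eq_zero hp.2 fun k hk => ?_
    rw [coeff_jacobiOp, coeff_X_pow, coeff_X_pow, if_neg (by omega), if_neg (by omega)]
    ring
  · rw [hcoeff, hN (N + 1) (by omega)]
    ring

/-- There are `N` linear conditions on a space of dimension `N + 1`; a nonzero solution has nonzero
top coefficient and can be normalized. -/
lemma exists_monic_isJacobiOrth (a s N : ℕ) :
    ∃ p : ℝ[X], IsJacobiOrth a s N p ∧ p.coeff N = 1 := by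
  let φ : degreeLT ℝ (N + 1) →ₗ[ℝ] Fin N → ℝ :=
    LinearMap.pi fun i => jacobiInt a s ∘ₗ LinearMap.mulRight ℝ (X ^ (i : ℕ)) ∘ₗ
      (degreeLT ℝ (N + 1)).subtype
  have hker : LinearMap.ker φ ≠ ⊥ := LinearMap.ker_ne_bot_of_finrank_lt (by
    rw [Module.finrank_fin_fun, (degreeLTEquiv ℝ (N + 1)).finrank_eq, Module.finrank_fin_fun]
    exact Nat.lt_succ_self N)
  obtain ⟨⟨p, hp⟩, hpk, hp0⟩ := Submodule.exists_mem_ne_zero_of_ne_bot hker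
  have horth : IsJacobiOrth a s N p := by
    refine ⟨?_, fun i hi => congrFun (LinearMap.mem_ker.mp hpk) ⟨i, hi⟩⟩
    rw [natDegree_le_iff_coeff_eq_zero]
    intro i hi
    rw [mem_degreeLT] at hp
    exact coeff_eq_zero_of_degree_lt (hp.trans_le (by exact_mod_cast hi))
  have hc : p.coeff N ≠ 0 := fun h => hp0 (Subtype.ext (horth.eq_zero h))
  exact ⟨_, horth.C_mul (p.coeff N)⁻¹, by simp [hc]⟩

end ConicSurface

end

/-! ### Orthogonal polynomials on the conic surface -/

noncomputable section

namespace ConicSurface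

open MeasureTheory Set

lemma smul_mem_V0 {d : ℕ} {ξ : E d} (hξ : ξ ∈ Metric.sphere (0 : E d) 1) {t : ℝ}
    (ht : t ∈ Icc (0 : ℝ) 1) : ((t • ξ, t) : E d × ℝ) ∈ V0 d := by
  have h1 : ‖ξ‖ = 1 := by simpa using hξ
  exact ⟨by simp [norm_smul, h1, abs_of_nonneg ht.1], ht.1, ht.2⟩

lemma polar_of_mem {d : ℕ} (f : V0 d → ℝ) {ξ : E d} (hξ : ξ ∈ Metric.sphere (0 : E d) 1) {t : ℝ}
    (ht : t ∈ Icc (0 : ℝ) 1) : polar f ξ t = f ⟨(t • ξ, t), smul_mem_V0 hξ ht⟩ :=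
  dif_pos (smul_mem_V0 hξ ht)

/-- The point of `ℝ^d × ℝ` as a valuation of the variables. -/
def coneVars {d : ℕ} (x : E d) (t : ℝ) : Fin d ⊕ Unit → ℝ :=
  Sum.elim (fun i => x i) (fun _ => t)

/-- Restriction of polynomials in `(x,t)` to the conic surface. -/
def restr (d : ℕ) : MvPolynomial (Fin d ⊕ Unit) ℝ →ₗ[ℝ] (V0 d → ℝ) where
  toFun q z := MvPolynomial.eval (coneVars z.1.1 z.1.2) q
  map_add' p q := by
    ext z
    simp
  map_smul' c q := by
    ext z
    simp [MvPolynomial.smul_eval]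

lemma restr_apply {d : ℕ} (q : MvPolynomial (Fin d ⊕ Unit) ℝ) (z : V0 d) :
    restr d q z = MvPolynomial.eval (coneVars z.1.1 z.1.2) q := rfl

lemma mem_conePoly {d k : ℕ} {f : V0 d → ℝ} :
    f ∈ conePoly d k ↔ ∃ q : MvPolynomial (Fin d ⊕ Unit) ℝ, q.totalDegree ≤ k ∧ f = restr d q := by
  simp only [conePoly, mem_ofPred_eq, funext_iff]
  rfl

lemma polar_restr {d : ℕ} (q : MvPolynomial (Fin d ⊕ Unit) ℝ) {ξ : E d}
    (hξ : ξ ∈ Metric.sphere (0 : E d) 1) {t : ℝ} (ht : t ∈ Icc (0 : ℝ) 1) :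
    polar (restr d q) ξ t = MvPolynomial.eval (coneVars (t • ξ) t) q := by
  rw [polar_of_mem _ hξ ht, restr_apply]

lemma continuous_coneVars_smul (d : ℕ) :
    Continuous fun z : ℝ × Metric.sphere (0 : E d) 1 => coneVars (z.1 • (z.2 : E d)) z.1 := by
  refine continuous_pi fun i => ?_
  rcases i with i | _
  · simp only [coneVars, Sum.elim_inl, PiLp.smul_apply, smul_eq_mul]
    fun_prop
  · simp only [coneVars, Sum.elim_inr]
    fun_prop

/-- The integral of a polynomial over the slice at height `t`, pulled back to the sphere. -/
def sliceInt {d : ℕ} (q : MvPolynomial (Fin d ⊕ Unit) ℝ) (t : ℝ) : ℝ :=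
  ∫ ξ : Metric.sphere (0 : E d) 1, MvPolynomial.eval (coneVars (t • (ξ : E d)) t) q
    ∂((volume : Measure (E d)).toSphere)

lemma continuous_sliceInt {d : ℕ} (q : MvPolynomial (Fin d ⊕ Unit) ℝ) :
    Continuous (sliceInt q) := by
  have h := continuous_parametric_integral_of_continuous
    (μ := (volume : Measure (E d)).toSphere)
    (f := fun t (ξ : Metric.sphere (0 : E d) 1) => MvPolynomial.eval (coneVars (t • (ξ : E d)) t) q)
    ((MvPolynomial.continuous_eval q).comp (continuous_coneVars_smul d)) isCompact_univ
  simpa only [setIntegral_univ] using! h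

lemma integrable_slice {d : ℕ} (q : MvPolynomial (Fin d ⊕ Unit) ℝ) (t : ℝ) :
    Integrable (fun ξ : Metric.sphere (0 : E d) 1 =>
      MvPolynomial.eval (coneVars (t • (ξ : E d)) t) q) (volume : Measure (E d)).toSphere :=
  Continuous.integrable_of_hasCompactSupport
    ((MvPolynomial.continuous_eval q).comp
      ((continuous_coneVars_smul d).comp (Continuous.prodMk_right t)))
    (HasCompactSupport.of_compactSpace _)

/-- The integral of polynomials over the conic surface against `t^{-1} (1-t)^s`. -/
def coneInt (d s : ℕ) : MvPolynomial (Fin d ⊕ Unit) ℝ →ₗ[ℝ] ℝ where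
  toFun q := ∫ t in (0 : ℝ)..1, sliceInt q t * (t ^ (d - 2) * (1 - t) ^ s)
  map_add' p q := by
    have h : ∀ t, sliceInt (p + q) t = sliceInt p t + sliceInt q t := fun t => by
      simp only [sliceInt, map_add]
      exact integral_add (integrable_slice p t) (integrable_slice q t)
    simp only [h, add_mul]
    have := continuous_sliceInt p
    have := continuous_sliceInt q
    exact intervalIntegral.integral_add (by apply Continuous.intervalIntegrable; fun_prop)
      (by apply Continuous.intervalIntegrable; fun_prop)
  map_smul' c q := by
    have h : ∀ t, sliceInt (c • q) t = c * sliceInt q t := fun t => by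
      simp only [sliceInt, MvPolynomial.smul_eval, integral_const_mul]
    simp [h, mul_assoc]

lemma coneInt_apply {d : ℕ} (s : ℕ) (q : MvPolynomial (Fin d ⊕ Unit) ℝ) :
    coneInt d s q = ∫ t in (0 : ℝ)..1, sliceInt q t * (t ^ (d - 2) * (1 - t) ^ s) := rfl

lemma coneInner_restr {d : ℕ} (hd : 2 ≤ d) (s : ℕ) (p q : MvPolynomial (Fin d ⊕ Unit) ℝ) :
    coneInner (-1) s (restr d p) (restr d q) = coneInt d s (p * q) := by
  rw [coneInner, coneInt_apply, intervalIntegral.integral_of_le zero_le_one,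
    intervalIntegral.integral_of_le zero_le_one]
  -- On `(0,1]` one has `t^(d-1) t^(-1) = t^(d-2)`. The excluded point `t = 0` matters: for `d = 2`
  -- the two sides take different default values there.
  refine setIntegral_congr_fun measurableSet_Ioc fun t ht => ?_
  have hpq : ∀ ξ : Metric.sphere (0 : E d) 1,
      polar (restr d p) (ξ : E d) t * polar (restr d q) (ξ : E d) t
        = MvPolynomial.eval (coneVars (t • (ξ : E d)) t) (p * q) := fun ξ => by
    rw [polar_restr p ξ.2 (Ioc_subset_Icc_self ht), polar_restr q ξ.2 (Ioc_subset_Icc_self ht),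
      map_mul]
  simp only [hpq]
  obtain ⟨e, rfl⟩ := Nat.exists_eq_add_of_le' hd
  rw [Real.rpow_neg_one, Real.rpow_natCast, show e + 2 - 1 = e + 1 by omega,
    show e + 2 - 2 = e by omega]
  have ht0 : t ≠ 0 := ht.1.ne'
  change t ^ (e + 1) * sliceInt (p * q) t * _ = _
  field_simp
  ring

/-- The polynomial `p(t) Y(x)`. -/
def radialTerm {d : ℕ} (p : Polynomial ℝ) (Y : MvPolynomial (Fin d) ℝ) :
    MvPolynomial (Fin d ⊕ Unit) ℝ :=
  Polynomial.aeval (MvPolynomial.X (Sum.inr ())) p * MvPolynomial.rename Sum.inl Y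

lemma eval_radialTerm {d : ℕ} (p : Polynomial ℝ) (Y : MvPolynomial (Fin d) ℝ) (x : E d) (t : ℝ) :
    MvPolynomial.eval (coneVars x t) (radialTerm p Y)
      = p.eval t * MvPolynomial.eval (fun i => x i) Y := by
  rw [radialTerm, map_mul, MvPolynomial.eval_rename]
  congr 1
  rw [← MvPolynomial.coe_aeval_eq_eval, RingHom.coe_coe, ← Polynomial.aeval_algHom_apply]
  simp [coneVars]

lemma restr_radialTerm {d : ℕ} (p : Polynomial ℝ) (Y : MvPolynomial (Fin d) ℝ) :
    restr d (radialTerm p Y) = mulHarmonic (fun t => p.eval t) Y := by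
  ext z
  rw [restr_apply, eval_radialTerm, mulHarmonic]

lemma totalDegree_radialTerm_le {d k N : ℕ} {p : Polynomial ℝ} (hp : p.natDegree ≤ N)
    {Y : MvPolynomial (Fin d) ℝ} (hY : Y.IsHomogeneous k) :
    (radialTerm p Y).totalDegree ≤ N + k := by
  refine (MvPolynomial.totalDegree_mul _ _).trans (add_le_add ?_ ?_)
  · rw [Polynomial.aeval_eq_sum_range]
    refine MvPolynomial.totalDegree_finsetSum_le fun i hi => ?_
    refine (MvPolynomial.totalDegree_smul_le _ _).trans ?_
    rw [MvPolynomial.totalDegree_X_pow]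
    exact (Finset.mem_range_succ_iff.mp hi).trans hp
  · exact (MvPolynomial.totalDegree_rename_le _ _).trans hY.totalDegree_le

/-- Putting `x = tξ` releases `t^(k+l)`, which joins the weight; for `k = l` this is the source of
the parameter `2k+d-2`. -/
lemma coneInt_radialTerm_mul {d k l : ℕ} (s : ℕ) (p q : Polynomial ℝ)
    {Y Z : MvPolynomial (Fin d) ℝ} (hY : Y.IsHomogeneous k) (hZ : Z.IsHomogeneous l) :
    coneInt d s (radialTerm p Y * radialTerm q Z)
      = sphereInt d (Y * Z) * jacobiInt (k + l + (d - 2)) s (p * q) := by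
  rw [coneInt_apply, jacobiInt_apply, ← intervalIntegral.integral_const_mul]
  congr 1
  ext t
  have h : sliceInt (radialTerm p Y * radialTerm q Z) t
      = p.eval t * q.eval t * t ^ (k + l) * sphereInt d (Y * Z) := by
    rw [sliceInt, sphereInt_apply, ← integral_const_mul]
    refine integral_congr_ae (Filter.Eventually.of_forall fun ξ => ?_)
    simp only [map_mul, eval_radialTerm, PiLp.smul_apply, smul_eq_mul]
    rw [eval_smul_of_isHomogeneous hY, eval_smul_of_isHomogeneous hZ]
    ring
  rw [h, Polynomial.eval_mul]
  ring

lemma coneInt_radialTerm_mul_of_ne {d k l : ℕ} (hd : 0 < d) (hkl : k ≠ l) (s : ℕ)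
    (p q : Polynomial ℝ) {Y Z : MvPolynomial (Fin d) ℝ} (hY : Y ∈ solidHarmonics d k)
    (hZ : Z ∈ solidHarmonics d l) : coneInt d s (radialTerm p Y * radialTerm q Z) = 0 := by
  rw [coneInt_radialTerm_mul s p q hY.1 hZ.1, sphereInt_mul_eq_zero hd hkl hY hZ, zero_mul]

/-- The span of the functions `t^i Y(x)` with `Y` a solid harmonic of degree at most `m - i`. -/
def coneSpan (d m : ℕ) : Submodule ℝ (V0 d → ℝ) :=
  Submodule.span ℝ {f | ∃ i k, i + k ≤ m ∧ ∃ Y ∈ solidHarmonics d k,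
    f = restr d (radialTerm (Polynomial.X ^ i) Y)}

lemma pow_mul_mem_coneSpan {d m : ℕ} (j : ℕ) {f : V0 d → ℝ} (hf : f ∈ coneSpan d m) :
    (fun z : V0 d => z.1.2 ^ j * f z) ∈ coneSpan d (j + m) := by
  induction hf using Submodule.span_induction with
  | mem f hf =>
    obtain ⟨i, k, hik, Y, hY, rfl⟩ := hf
    refine Submodule.subset_span ⟨j + i, k, by omega, Y, hY, ?_⟩
    ext z
    simp only [restr_apply, eval_radialTerm, Polynomial.eval_pow, Polynomial.eval_X]
    ring
  | zero =>
    simp only [Pi.zero_apply, mul_zero]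
    exact Submodule.zero_mem (coneSpan d (j + m))
  | add f g _ _ hf hg =>
    simp only [Pi.add_apply, mul_add]
    exact Submodule.add_mem _ hf hg
  | smul c f _ hf =>
    simp only [Pi.smul_apply, smul_eq_mul, mul_left_comm _ c]
    exact Submodule.smul_mem _ c hf

lemma coneSpan_mono {d m m' : ℕ} (h : m ≤ m') : coneSpan d m ≤ coneSpan d m' :=
  Submodule.span_mono fun _ ⟨i, k, hik, Y, hY, hf⟩ => ⟨i, k, hik.trans h, Y, hY, hf⟩

/-- On the cone `‖x‖² = t²`, so the factors `‖x‖²` in the harmonic decomposition become powers of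
`t`. -/
lemma eval_mem_coneSpan {d : ℕ} (hd : 0 < d) (k : ℕ) (p : MvPolynomial (Fin d) ℝ)
    (hp : p.IsHomogeneous k) :
    (fun z : V0 d => MvPolynomial.eval (fun i => z.1.1 i) p) ∈ coneSpan d k := by
  have hharm : ∀ (k : ℕ) (Y : MvPolynomial (Fin d) ℝ), Y ∈ solidHarmonics d k →
      (fun z : V0 d => MvPolynomial.eval (fun i => z.1.1 i) Y) ∈ coneSpan d k := by
    refine fun k Y hY => Submodule.subset_span ⟨0, k, by omega, Y, hY, ?_⟩
    ext z
    simp [restr_apply, eval_radialTerm]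
  induction k using Nat.strong_induction_on generalizing p with
  | _ k ih =>
    rcases lt_or_ge k 2 with hk | hk
    · exact hharm k p (mem_harmonicSubmodule.mp ⟨hp, polyLaplacian_eq_zero_of_lt_two hk hp⟩)
    · obtain ⟨j, rfl⟩ := Nat.exists_eq_add_of_le' hk
      obtain ⟨Y, hY, q, hq, rfl⟩ := (harmonicOrth hd j).exists_decomp hd hp
      have h2 := pow_mul_mem_coneSpan 2 (ih j (by omega) q hq)
      rw [add_comm 2 j] at h2
      convert! Submodule.add_mem _ (hharm (j + 2) Y hY) h2 using 1
      ext z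
      have hz : ‖z.1.1‖ = z.1.2 := z.2.1
      simp [eval_normSqPoly, hz]

lemma conePoly_subset_coneSpan {d m : ℕ} (hd : 0 < d) {f : V0 d → ℝ} (hf : f ∈ conePoly d m) :
    f ∈ coneSpan d m := by
  obtain ⟨q, hq, rfl⟩ := mem_conePoly.mp hf
  rw [q.as_sum, map_sum]
  refine Submodule.sum_mem _ fun b hb => ?_
  have hdeg : b (Sum.inr ()) + ∑ i : Fin d, b (Sum.inl i) ≤ m := by
    have h := (MvPolynomial.le_totalDegree hb).trans hq
    rw [Finsupp.sum_fintype _ _ (by simp), Fintype.sum_sum_type] at h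
    simpa [add_comm] using h
  refine coneSpan_mono hdeg ?_
  set a : Fin d →₀ ℕ := Finsupp.equivFunOnFinite.symm fun i => b (Sum.inl i) with ha
  have hom : (MvPolynomial.monomial a (MvPolynomial.coeff b q)).IsHomogeneous
      (∑ i : Fin d, b (Sum.inl i)) :=
    MvPolynomial.isHomogeneous_monomial _ (by rw [Finsupp.degree_eq_sum]; simp [ha])
  convert! pow_mul_mem_coneSpan (b (Sum.inr ())) (eval_mem_coneSpan hd _ _ hom) using 1
  ext z
  rw [restr_apply, MvPolynomial.eval_monomial, MvPolynomial.eval_monomial,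
    Finsupp.prod_fintype _ _ (by simp), Finsupp.prod_fintype _ _ (by simp),
    Fintype.prod_sum_type]
  simp only [coneVars, Sum.elim_inl, Finset.univ_unique, PUnit.default_eq_unit, Sum.elim_inr,
    Finset.prod_singleton, ha, Finsupp.equivFunOnFinite_symm_apply_apply]
  ring

lemma exists_of_mem_coneSpan {d m : ℕ} {f : V0 d → ℝ} (hf : f ∈ coneSpan d m) :
    ∃ Y : ℕ → ℕ → MvPolynomial (Fin d) ℝ, (∀ k i, Y k i ∈ harmonicSubmodule d k) ∧
      f = restr d (∑ k ∈ Finset.range (m + 1), ∑ i ∈ Finset.range (m - k + 1),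
        radialTerm (Polynomial.X ^ i) (Y k i)) := by
  induction hf using Submodule.span_induction with
  | mem f hf =>
    obtain ⟨i, k, hik, Y, hY, rfl⟩ := hf
    refine ⟨fun k' i' => if k' = k ∧ i' = i then Y else 0, fun k' i' => ?_, ?_⟩
    · dsimp only
      split_ifs with h
      · rw [h.1]
        exact mem_harmonicSubmodule.mpr hY
      · exact Submodule.zero_mem _
    · rw [Finset.sum_eq_single_of_mem k (by simp; omega), Finset.sum_eq_single_of_mem i
        (by simp; omega)]
      · simp
      · intro i' _ hi'
        simp [hi', radialTerm]
      · intro k' _ hk'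
        simp [hk', radialTerm]
  | zero => exact ⟨0, fun _ _ => Submodule.zero_mem _, by simp [radialTerm]⟩
  | add f g _ _ hf hg =>
    obtain ⟨Y, hY, rfl⟩ := hf
    obtain ⟨Z, hZ, rfl⟩ := hg
    refine ⟨Y + Z, fun k i => Submodule.add_mem _ (hY k i) (hZ k i), ?_⟩
    rw [← map_add]
    simp only [Pi.add_apply, radialTerm, map_add, mul_add, Finset.sum_add_distrib]
  | smul c f _ hf =>
    obtain ⟨Y, hY, rfl⟩ := hf
    refine ⟨c • Y, fun k i => Submodule.smul_mem _ c (hY k i), ?_⟩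
    rw [← map_smul]
    simp only [Pi.smul_apply, radialTerm, map_smul, mul_smul_comm, Finset.smul_sum]

/-- The monic polynomial of degree `N` that is orthogonal to all polynomials of smaller degree for
the weight `t^a (1-t)^s` on `[0,1]`. -/
def monicJacobi (a s N : ℕ) : Polynomial ℝ := (exists_monic_isJacobiOrth a s N).choose

lemma monicJacobi_isJacobiOrth (a s N : ℕ) : IsJacobiOrth a s N (monicJacobi a s N) :=
  (exists_monic_isJacobiOrth a s N).choose_spec.1

lemma coeff_monicJacobi (a s N : ℕ) : (monicJacobi a s N).coeff N = 1 :=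
  (exists_monic_isJacobiOrth a s N).choose_spec.2

lemma monicJacobi_ne_zero (a s N : ℕ) : monicJacobi a s N ≠ 0 := by
  intro h
  simpa [h] using coeff_monicJacobi a s N

lemma coneInt_expansion_mul_radialTerm {d m k : ℕ} (hd : 0 < d) (s : ℕ)
    {Y : ℕ → ℕ → MvPolynomial (Fin d) ℝ} (hY : ∀ k i, Y k i ∈ harmonicSubmodule d k)
    {Z : MvPolynomial (Fin d) ℝ} (hZ : Z ∈ harmonicSubmodule d k) (q : Polynomial ℝ)  :
    coneInt d s ((∑ k ∈ Finset.range (m + 1), ∑ i ∈ Finset.range (m - k + 1),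
        radialTerm (Polynomial.X ^ i) (Y k i)) * radialTerm q Z)
      = if k ≤ m then ∑ i ∈ Finset.range (m - k + 1),
          sphereInt d (Y k i * Z) * jacobiInt (k + k + (d - 2)) s (Polynomial.X ^ i * q) else 0 := by
  have hne : ∀ k', k' ≠ k → ∀ i, coneInt d s (radialTerm (Polynomial.X ^ i) (Y k' i)
      * radialTerm q Z) = 0 := fun k' hk' i =>
    coneInt_radialTerm_mul_of_ne hd hk' s _ _ (mem_harmonicSubmodule.mp (hY k' i))
      (mem_harmonicSubmodule.mp hZ)
  simp only [Finset.sum_mul, map_sum]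
  split_ifs with hk
  · rw [Finset.sum_eq_single_of_mem k (by simp; omega)]
    · exact Finset.sum_congr rfl fun i _ => coneInt_radialTerm_mul s _ _ (hY k i).1 hZ.1
    · exact fun k' _ hk' => Finset.sum_eq_zero fun i _ => hne k' hk' i
  · refine Finset.sum_eq_zero fun k' hk' => Finset.sum_eq_zero fun i _ => hne k' ?_ i
    rw [Finset.mem_range] at hk'
    omega

lemma restr_radialTerm_monicJacobi_mem_orthPoly {d m k : ℕ} (hd : 2 ≤ d) (s : ℕ) (hk : k ≤ m)
    {Z : MvPolynomial (Fin d) ℝ} (hZ : Z ∈ harmonicSubmodule d k) :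
    restr d (radialTerm (monicJacobi (k + k + (d - 2)) s (m - k)) Z) ∈ orthPoly d m (-1) s := by
  refine ⟨mem_conePoly.mpr ⟨_, ?_, rfl⟩, fun j hj g hg => ?_⟩
  · have := totalDegree_radialTerm_le (monicJacobi_isJacobiOrth (k + k + (d - 2)) s (m - k)).1 hZ.1
    omega
  · obtain ⟨Y, hY, rfl⟩ := exists_of_mem_coneSpan (conePoly_subset_coneSpan (by omega) hg)
    rw [coneInner_restr hd, mul_comm, coneInt_expansion_mul_radialTerm (by omega) s hY hZ]
    split_ifs with hkj
    · refine Finset.sum_eq_zero fun i hi => ?_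
      rw [Finset.mem_range] at hi
      rw [mul_comm (Polynomial.X ^ i), (monicJacobi_isJacobiOrth _ s (m - k)).2 i (by omega),
        mul_zero]
    · rfl

/-- In the expansion `∑ t^i Y_{k,i}(x)`, pairing the degree `k` part on the sphere with any harmonic
`Z` leaves a polynomial in `t` that inherits the orthogonality. It is thus a multiple of
`monicJacobi`, and so `Y_{k,i}` is a fixed multiple of `Y_{k,m-k}`. -/
lemma exists_of_mem_orthPoly {d m : ℕ} (hd : 2 ≤ d) (s : ℕ) {g : V0 d → ℝ}
    (hg : g ∈ orthPoly d m (-1) s) :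
    ∃ Y : ℕ → MvPolynomial (Fin d) ℝ, (∀ k, Y k ∈ harmonicSubmodule d k) ∧
      g = ∑ k ∈ Finset.range (m + 1),
        restr d (radialTerm (monicJacobi (k + k + (d - 2)) s (m - k)) (Y k)) := by
  have hd0 : 0 < d := by omega
  obtain ⟨Y, hY, hgY⟩ := exists_of_mem_coneSpan (conePoly_subset_coneSpan hd0 hg.1)
  have key : ∀ k ≤ m, ∀ i ≤ m - k,
      Y k i = (monicJacobi (k + k + (d - 2)) s (m - k)).coeff i • Y k (m - k) := by
    intro k hk i hi
    set P := monicJacobi (k + k + (d - 2)) s (m - k) with hP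
    have hform : ∀ Z ∈ harmonicSubmodule d k,
        sphereInt d (Y k i * Z) = P.coeff i * sphereInt d (Y k (m - k) * Z) := by
      intro Z hZ
      set p : Polynomial ℝ := ∑ i ∈ Finset.range (m - k + 1),
        Polynomial.C (sphereInt d (Y k i * Z)) * Polynomial.X ^ i with hp
      have hcoeff : ∀ i ≤ m - k, p.coeff i = sphereInt d (Y k i * Z) := by
        intro i hi
        rw [hp, Polynomial.finsetSum_coeff]
        simp only [Polynomial.coeff_C_mul_X_pow]
        rw [Finset.sum_ite_eq, if_pos (by simp; omega)]
      have hpo : IsJacobiOrth (k + k + (d - 2)) s (m - k) p := by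
        constructor
        · refine Polynomial.natDegree_sum_le_of_forall_le _ _ fun i hi => ?_
          exact (Polynomial.natDegree_C_mul_X_pow_le _ _).trans (Finset.mem_range_succ_iff.mp hi)
        · intro l hl
          have h0 := hg.2 (l + k) (by omega) (restr d (radialTerm (Polynomial.X ^ l) Z))
            (mem_conePoly.mpr ⟨_, totalDegree_radialTerm_le
              (Polynomial.natDegree_X_pow_le l) hZ.1, rfl⟩)
          rw [hgY, coneInner_restr hd, coneInt_expansion_mul_radialTerm hd0 s hY hZ,
            if_pos hk] at h0
          rw [hp, Finset.sum_mul, map_sum, ← h0]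
          refine Finset.sum_congr rfl fun i _ => ?_
          rw [mul_assoc, ← Polynomial.smul_eq_C_mul, map_smul, smul_eq_mul]
      have h := (monicJacobi_isJacobiOrth (k + k + (d - 2)) s (m - k)).eq_C_mul hpo
        (coeff_monicJacobi _ _ _)
      rw [← hcoeff i hi, ← hcoeff (m - k) le_rfl]
      conv_lhs => rw [h, Polynomial.coeff_C_mul]
      rw [mul_comm]
    -- This difference is itself an admissible `Z`, so it is orthogonal to itself.
    have hmem : Y k i - P.coeff i • Y k (m - k) ∈ harmonicSubmodule d k :=
      Submodule.sub_mem _ (hY k i) (Submodule.smul_mem _ _ (hY k _))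
    refine sub_eq_zero.mp (eq_zero_of_sphereInt_mul_self hd0 hmem.1 ?_)
    rw [sub_mul, map_sub, hform _ hmem, smul_mul_assoc, map_smul, smul_eq_mul, sub_self]
  refine ⟨fun k => Y k (m - k), fun k => hY k _, ?_⟩
  rw [hgY, map_sum]
  refine Finset.sum_congr rfl fun k hk => ?_
  have hk' : k ≤ m := Finset.mem_range_succ_iff.mp hk
  ext z
  rw [map_sum, Finset.sum_apply, restr_apply, eval_radialTerm,
    Polynomial.eval_eq_sum_range' (Nat.lt_succ_of_le
      (monicJacobi_isJacobiOrth (k + k + (d - 2)) s (m - k)).1), Finset.sum_mul]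
  refine Finset.sum_congr rfl fun i hi => ?_
  rw [restr_apply, eval_radialTerm, key k hk' i (Finset.mem_range_succ_iff.mp hi),
    MvPolynomial.smul_eval, Polynomial.eval_pow, Polynomial.eval_X]
  ring

end ConicSurface

end

/-! ### The differential operator on the conic surface -/

noncomputable section

namespace ConicSurface

open MeasureTheory Set

/-- The derivative of a polynomial function on `ℝ^d`. -/
def polyFDeriv {d : ℕ} (p : MvPolynomial (Fin d) ℝ) (x : E d) : E d →L[ℝ] ℝ :=
  ∑ i, MvPolynomial.eval (fun j => x j) (MvPolynomial.pderiv i p) • EuclideanSpace.proj i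

lemma hasFDerivAt_eval {d : ℕ} (p : MvPolynomial (Fin d) ℝ) (x : E d) :
    HasFDerivAt (fun y : E d => MvPolynomial.eval (fun j => y j) p) (polyFDeriv p x) x := by
  induction p using MvPolynomial.induction_on with
  | C c => simpa [polyFDeriv] using hasFDerivAt_const c x
  | add p q hp hq =>
    simp only [map_add]
    convert! hp.add hq using 1
    simp [polyFDeriv, add_smul, Finset.sum_add_distrib]
  | mul_X p i hp =>
    simp only [map_mul, MvPolynomial.eval_X]
    have hX : HasFDerivAt (fun y : E d => y i)
        (EuclideanSpace.proj i : E d →L[ℝ] ℝ) x :=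
      (EuclideanSpace.proj i : E d →L[ℝ] ℝ).hasFDerivAt
    convert! hp.mul hX using 1
    ext v
    simp only [polyFDeriv, Derivation.leibniz, smul_eq_mul, map_add, map_mul, MvPolynomial.eval_X,
      MvPolynomial.pderiv_X, add_smul, Finset.sum_add_distrib, _root_.add_apply,
      _root_.sum_apply, _root_.smul_apply, PiLp.proj_apply]
    congr 1
    · rw [Finset.sum_eq_single_of_mem i (Finset.mem_univ i)]
      · simp
      · intro j _ hj
        simp [hj.symm]
    · rw [Finset.mul_sum]
      exact Finset.sum_congr rfl fun j _ => by ring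

lemma polyFDeriv_basisFun {d : ℕ} (p : MvPolynomial (Fin d) ℝ) (x : E d) (i : Fin d) :
    polyFDeriv p x (EuclideanSpace.basisFun (Fin d) ℝ i)
      = MvPolynomial.eval (fun j => x j) (MvPolynomial.pderiv i p) := by
  simp [polyFDeriv]

lemma contDiff_eval {d : ℕ} (p : MvPolynomial (Fin d) ℝ) :
    ContDiff ℝ 2 fun y : E d => MvPolynomial.eval (fun j => y j) p := by
  simp only [MvPolynomial.eval_eq]
  fun_prop

/-- The function `‖x‖^{2a} p(x)`. -/
def normPowMul {d : ℕ} (a : ℝ) (p : MvPolynomial (Fin d) ℝ) (x : E d) : ℝ :=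
  (‖x‖ ^ 2) ^ a * MvPolynomial.eval (fun i => x i) p

lemma contDiffAt_normPowMul {d : ℕ} (a : ℝ) (p : MvPolynomial (Fin d) ℝ) {x : E d} (hx : x ≠ 0) :
    ContDiffAt ℝ 2 (normPowMul a p) x := by
  refine ContDiffAt.mul ?_ (contDiff_eval p).contDiffAt
  exact (contDiff_norm_sq ℝ).contDiffAt.rpow_const_of_ne (by positivity)

lemma fderiv_normPowMul_basisFun {d : ℕ} (a : ℝ) (p : MvPolynomial (Fin d) ℝ) {x : E d}
    (hx : x ≠ 0) (i : Fin d) :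
    fderiv ℝ (normPowMul a p) x (EuclideanSpace.basisFun (Fin d) ℝ i)
      = normPowMul (a - 1) (MvPolynomial.C (2 * a) * (MvPolynomial.X i * p)) x
        + normPowMul a (MvPolynomial.pderiv i p) x := by
  have h1 : ‖x‖ ^ 2 ≠ 0 := by positivity
  have h2 := ((hasStrictFDerivAt_norm_sq x).hasFDerivAt.rpow_const (p := a) (Or.inl h1)).mul
    (hasFDerivAt_eval p x)
  have h3 : fderiv ℝ (normPowMul a p) x = _ := h2.fderiv
  rw [h3, _root_.add_apply, _root_.smul_apply, polyFDeriv_basisFun]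
  simp only [_root_.smul_apply, normPowMul, smul_eq_mul, map_mul, MvPolynomial.eval_C, MvPolynomial.eval_X,
    coe_innerSL_apply, EuclideanSpace.basisFun_apply, EuclideanSpace.inner_single_right,
    conj_trivial, one_mul, nsmul_eq_mul, Nat.cast_ofNat]
  ring

lemma laplacian_normPowMul {d m : ℕ} {Y : MvPolynomial (Fin d) ℝ} (hY : Y ∈ solidHarmonics d m)
    (a : ℝ) {ξ : E d} (hξ : ‖ξ‖ = 1) :
    (Laplacian.laplacian (normPowMul a Y) : E d → ℝ) ξ
      = (4 * a * (a - 1) + 2 * a * d + 4 * a * m) * MvPolynomial.eval (fun i => ξ i) Y := by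
  have hξ0 : ξ ≠ 0 := by
    rintro rfl
    simp at hξ
  have hsq : ∑ i, ξ i * ξ i = 1 := by
    have := EuclideanSpace.norm_sq_eq ξ
    rw [hξ] at this
    simpa [sq] using this.symm
  have heuler : ∑ i, ξ i * MvPolynomial.eval (fun j => ξ j) (MvPolynomial.pderiv i Y)
      = m * MvPolynomial.eval (fun j => ξ j) Y := by
    have := congrArg (MvPolynomial.eval fun j => ξ j) hY.1.sum_X_mul_pderiv
    simpa using this
  have hlap : ∑ i, MvPolynomial.eval (fun j => ξ j)
      (MvPolynomial.pderiv i (MvPolynomial.pderiv i Y)) = 0 := by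
    have := congrArg (MvPolynomial.eval fun j => ξ j) hY.2
    simpa using this
  rw [InnerProductSpace.laplacian_eq_iteratedFDeriv_orthonormalBasis _
    (EuclideanSpace.basisFun (Fin d) ℝ)]
  have hterm : ∀ i, iteratedFDeriv ℝ 2 (normPowMul a Y) ξ
      ![EuclideanSpace.basisFun (Fin d) ℝ i, EuclideanSpace.basisFun (Fin d) ℝ i]
      = 4 * a * (a - 1) * MvPolynomial.eval (fun j => ξ j) Y * (ξ i * ξ i)
        + 2 * a * MvPolynomial.eval (fun j => ξ j) Y
        + 4 * a * (ξ i * MvPolynomial.eval (fun j => ξ j) (MvPolynomial.pderiv i Y))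
        + MvPolynomial.eval (fun j => ξ j) (MvPolynomial.pderiv i (MvPolynomial.pderiv i Y)) := by
    intro i
    rw [iteratedFDeriv_two_apply]
    simp only [Matrix.cons_val_zero, Matrix.cons_val_one]
    have hdiff : DifferentiableAt ℝ (fderiv ℝ (normPowMul a Y)) ξ :=
      ((contDiffAt_normPowMul a Y hξ0).fderiv_right (m := 1) (by norm_num)).differentiableAt
        (by norm_num)
    have h1 : fderiv ℝ (fun y => fderiv ℝ (normPowMul a Y) y
        (EuclideanSpace.basisFun (Fin d) ℝ i)) ξ (EuclideanSpace.basisFun (Fin d) ℝ i)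
        = fderiv ℝ (fderiv ℝ (normPowMul a Y)) ξ (EuclideanSpace.basisFun (Fin d) ℝ i)
          (EuclideanSpace.basisFun (Fin d) ℝ i) := by
      rw [fderiv_clm_apply hdiff (differentiableAt_const _)]
      simp
    have h2 : (fun y => fderiv ℝ (normPowMul a Y) y (EuclideanSpace.basisFun (Fin d) ℝ i))
        =ᶠ[nhds ξ] (normPowMul (a - 1) (MvPolynomial.C (2 * a) * (MvPolynomial.X i * Y))
          + normPowMul a (MvPolynomial.pderiv i Y)) := by
      filter_upwards [isOpen_ne.mem_nhds hξ0] with y hy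
      exact fderiv_normPowMul_basisFun a Y hy i
    have hd1 := (contDiffAt_normPowMul (a - 1)
      (MvPolynomial.C (2 * a) * (MvPolynomial.X i * Y)) hξ0).differentiableAt (by norm_num)
    have hd2 := (contDiffAt_normPowMul a (MvPolynomial.pderiv i Y) hξ0).differentiableAt
      (by norm_num)
    rw [← h1, h2.fderiv_eq, fderiv_add hd1 hd2, _root_.add_apply,
      fderiv_normPowMul_basisFun _ _ hξ0, fderiv_normPowMul_basisFun _ _ hξ0]
    simp only [normPowMul, hξ, one_pow, Real.one_rpow, one_mul, Derivation.leibniz, smul_eq_mul,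
      map_mul, map_add, MvPolynomial.eval_C, MvPolynomial.eval_X, MvPolynomial.pderiv_C,
      MvPolynomial.pderiv_X_self, mul_zero, add_zero, map_one]
    ring
  simp only [hterm, Finset.sum_add_distrib, ← Finset.mul_sum, hsq, heuler, hlap, Finset.sum_const,
    Finset.card_univ, Fintype.card_fin, nsmul_eq_mul]
  ring

lemma polar_radialTerm {d m : ℕ} (p : Polynomial ℝ) {Y : MvPolynomial (Fin d) ℝ}
    (hY : Y.IsHomogeneous m) {ξ : E d} (hξ : ξ ∈ Metric.sphere (0 : E d) 1) {t : ℝ}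
    (ht : t ∈ Icc (0 : ℝ) 1) :
    polar (restr d (radialTerm p Y)) ξ t
      = (p * Polynomial.X ^ m).eval t * MvPolynomial.eval (fun i => ξ i) Y := by
  rw [polar_restr _ hξ ht, eval_radialTerm]
  simp only [PiLp.smul_apply, smul_eq_mul]
  rw [eval_smul_of_isHomogeneous hY]
  simp only [Polynomial.eval_mul, Polynomial.eval_pow, Polynomial.eval_X]
  ring

lemma inv_norm_smul_mem_sphere {d : ℕ} {x : E d} (hx : x ≠ 0) :
    ‖x‖⁻¹ • x ∈ Metric.sphere (0 : E d) 1 := by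
  simp [norm_smul, hx]

/-- The extension of `Y` from the sphere that is homogeneous of degree zero is `‖x‖^(-m) Y(x)`, a
power `-m/2` of `‖x‖²`. -/
lemma polar_radialTerm_inv_norm_smul {d m : ℕ} (p : Polynomial ℝ) {Y : MvPolynomial (Fin d) ℝ}
    (hY : Y.IsHomogeneous m) {ξ : E d} (hξ : ξ ≠ 0) {t : ℝ} (ht : t ∈ Icc (0 : ℝ) 1) :
    (fun x : E d => polar (restr d (radialTerm p Y)) (‖x‖⁻¹ • x) t) =ᶠ[nhds ξ]
      ((p * Polynomial.X ^ m).eval t • normPowMul (-(m : ℝ) / 2) Y) := by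
  filter_upwards [isOpen_ne.mem_nhds hξ] with x hx
  rw [polar_radialTerm p hY (inv_norm_smul_mem_sphere hx) ht, Pi.smul_apply, smul_eq_mul,
    normPowMul]
  congr 1
  simp only [PiLp.smul_apply, smul_eq_mul]
  rw [eval_smul_of_isHomogeneous hY]
  congr 1
  rw [← Real.rpow_natCast, ← Real.rpow_natCast, ← Real.rpow_mul (norm_nonneg x),
    Real.inv_rpow (norm_nonneg x), ← Real.rpow_neg (norm_nonneg x)]
  congr 1
  push_cast
  ring

/-- Functions on the conic surface for which the operator `diffOp` consists of genuine
derivatives. -/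
def ConeSmooth {d : ℕ} (f : V0 d → ℝ) : Prop :=
  ∀ ξ ∈ Metric.sphere (0 : E d) 1, ContDiffOn ℝ 2 (fun τ => polar f ξ τ) (Icc 0 1) ∧
    ∀ t ∈ Icc (0 : ℝ) 1, ContDiffAt ℝ 2 (fun x : E d => polar f (‖x‖⁻¹ • x) t) ξ

lemma polar_add {d : ℕ} (f g : V0 d → ℝ) (ξ : E d) (t : ℝ) :
    polar (f + g) ξ t = polar f ξ t + polar g ξ t := by
  unfold polar
  split_ifs <;> simp

lemma polar_smul {d : ℕ} (c : ℝ) (f : V0 d → ℝ) (ξ : E d) (t : ℝ) :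
    polar (c • f) ξ t = c * polar f ξ t := by
  unfold polar
  split_ifs <;> simp

lemma polar_zero {d : ℕ} (ξ : E d) (t : ℝ) : polar (0 : V0 d → ℝ) ξ t = 0 := by
  unfold polar
  split_ifs <;> simp

lemma ConeSmooth.add {d : ℕ} {f g : V0 d → ℝ} (hf : ConeSmooth f) (hg : ConeSmooth g) :
    ConeSmooth (f + g) := by
  intro ξ hξ
  simp only [polar_add]
  exact ⟨(hf ξ hξ).1.add (hg ξ hξ).1, fun t ht => ((hf ξ hξ).2 t ht).add ((hg ξ hξ).2 t ht)⟩

lemma ConeSmooth.smul {d : ℕ} {f : V0 d → ℝ} (hf : ConeSmooth f) (c : ℝ) :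
    ConeSmooth (c • f) := by
  intro ξ hξ
  simp only [polar_smul]
  exact ⟨contDiffOn_const.mul (hf ξ hξ).1, fun t ht => contDiffAt_const.mul ((hf ξ hξ).2 t ht)⟩

lemma ConeSmooth.zero {d : ℕ} : ConeSmooth (0 : V0 d → ℝ) := by
  intro ξ hξ
  simp only [polar_zero]
  exact ⟨contDiffOn_const, fun t ht => contDiffAt_const⟩

/-- Smoothness is required because derivatives take default values where they do not exist. -/
lemma diffOp_add {d : ℕ} (γ : ℝ) {f g : V0 d → ℝ} (hf : ConeSmooth f) (hg : ConeSmooth g)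
    {ξ : E d} (hξ : ξ ∈ Metric.sphere (0 : E d) 1) {t : ℝ} (ht : t ∈ Icc (0 : ℝ) 1) :
    diffOp γ (f + g) ξ t = diffOp γ f ξ t + diffOp γ g ξ t := by
  have hu : UniqueDiffOn ℝ (Icc (0 : ℝ) 1) := uniqueDiffOn_Icc one_pos
  have hf1 := (hf ξ hξ).1 t ht
  have hg1 := (hg ξ hξ).1 t ht
  have h2 := InnerProductSpace.laplacian_congr_nhds (x := ξ)
    (f₁ := fun x : E d => polar f (‖x‖⁻¹ • x) t + polar g (‖x‖⁻¹ • x) t)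
    (f₂ := (fun x : E d => polar f (‖x‖⁻¹ • x) t) + fun x => polar g (‖x‖⁻¹ • x) t)
    Filter.EventuallyEq.rfl
  simp only [diffOp, laplaceBeltrami, polar_add]
  rw [iteratedDerivWithin_fun_add ht hu hf1 hg1, derivWithin_fun_add
    (hf1.differentiableWithinAt (by norm_num)) (hg1.differentiableWithinAt (by norm_num)),
    h2.eq_of_nhds, ((hf ξ hξ).2 t ht).laplacian_add ((hg ξ hξ).2 t ht)]
  ring

lemma diffOp_smul {d : ℕ} (γ : ℝ) {f : V0 d → ℝ} (hf : ConeSmooth f) (c : ℝ)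
    {ξ : E d} (hξ : ξ ∈ Metric.sphere (0 : E d) 1) {t : ℝ} (ht : t ∈ Icc (0 : ℝ) 1) :
    diffOp γ (c • f) ξ t = c * diffOp γ f ξ t := by
  have hu : UniqueDiffOn ℝ (Icc (0 : ℝ) 1) := uniqueDiffOn_Icc one_pos
  have hf1 := (hf ξ hξ).1 t ht
  have h2 : (fun x : E d => c * polar f (‖x‖⁻¹ • x) t)
    = c • fun x : E d => polar f (‖x‖⁻¹ • x) t := rfl
  simp only [diffOp, laplaceBeltrami, polar_smul]
  rw [iteratedDerivWithin_const_mul ht hu c hf1, derivWithin_const_mul c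
    (hf1.differentiableWithinAt (by norm_num)), h2,
    InnerProductSpace.laplacian_smul c ((hf ξ hξ).2 t ht), smul_eq_mul]
  ring

lemma diffOp_zero {d : ℕ} (γ : ℝ) (ξ : E d) (t : ℝ) : diffOp γ (0 : V0 d → ℝ) ξ t = 0 := by
  simp only [diffOp, laplaceBeltrami, polar_zero]
  simp

lemma contDiff_polynomial_eval (p : Polynomial ℝ) : ContDiff ℝ 2 fun t => p.eval t := by
  simpa using p.contDiff_aeval (𝕜 := ℝ) 2

lemma coneSmooth_radialTerm {d m : ℕ} (p : Polynomial ℝ) {Y : MvPolynomial (Fin d) ℝ}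
    (hY : Y.IsHomogeneous m) : ConeSmooth (restr d (radialTerm p Y)) := by
  intro ξ hξ
  have hξ0 : ξ ≠ 0 := by
    rintro rfl
    simp at hξ
  constructor
  · have : ContDiffOn ℝ 2 (fun τ => (p * Polynomial.X ^ m).eval τ
        * MvPolynomial.eval (fun i => ξ i) Y) (Icc 0 1) :=
      ((contDiff_polynomial_eval (p * Polynomial.X ^ m)).mul contDiff_const).contDiffOn
    exact this.congr fun t ht => polar_radialTerm p hY hξ ht
  · intro t ht
    have h : ContDiffAt ℝ 2 ((p * Polynomial.X ^ m).eval t • normPowMul (-(m : ℝ) / 2) Y) ξ :=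
      (contDiffAt_normPowMul (-(m : ℝ) / 2) Y hξ0).const_smul ((p * Polynomial.X ^ m).eval t)
    exact h.congr_of_eventuallyEq (polar_radialTerm_inv_norm_smul p hY hξ0 ht)

lemma laplaceBeltrami_radialTerm {d m : ℕ} (p : Polynomial ℝ) {Y : MvPolynomial (Fin d) ℝ}
    (hY : Y ∈ solidHarmonics d m) {ξ : E d} (hξ : ξ ∈ Metric.sphere (0 : E d) 1) {t : ℝ}
    (ht : t ∈ Icc (0 : ℝ) 1) :
    laplaceBeltrami (fun η => polar (restr d (radialTerm p Y)) η t) ξ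
      = -(m * (m + d - 2)) * ((p * Polynomial.X ^ m).eval t
        * MvPolynomial.eval (fun i => ξ i) Y) := by
  have hξ1 : ‖ξ‖ = 1 := by simpa using hξ
  have hξ0 : ξ ≠ 0 := by
    rintro rfl
    simp at hξ
  rw [laplaceBeltrami, (InnerProductSpace.laplacian_congr_nhds
    (polar_radialTerm_inv_norm_smul p hY.1 hξ0 ht)).eq_of_nhds,
    InnerProductSpace.laplacian_smul _ (contDiffAt_normPowMul _ Y hξ0),
    laplacian_normPowMul hY _ hξ1, smul_eq_mul]
  ring

/-- Conjugation by `t^m` turns the Euler operator `t d/dt` into `t d/dt + m`; the extra factor `t`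
avoids the exponent `m - 1`. -/
lemma X_mul_derivative_mul_X_pow (p : Polynomial ℝ) (m : ℕ) :
    Polynomial.X * Polynomial.derivative (p * Polynomial.X ^ m)
      = (Polynomial.X * Polynomial.derivative p + (m : Polynomial ℝ) * p) * Polynomial.X ^ m := by
  rcases m with _ | m
  · simp
  · simp only [Polynomial.derivative_mul, Polynomial.derivative_X_pow, Nat.add_sub_cancel,
      map_natCast]
    ring

lemma diffOp_radialTerm {d m : ℕ} {s n : ℝ} {p : Polynomial ℝ} {Y : MvPolynomial (Fin d) ℝ}
    (hY : Y ∈ solidHarmonics d m)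
    (hp : jacobiOp (2 * m + d - 2) (-s) p
      + Polynomial.C ((n - m) * (n + m + d - 1 - s)) * p = 0)
    {ξ : E d} (hξ : ξ ∈ Metric.sphere (0 : E d) 1) {t : ℝ} (ht : t ∈ Ioc (0 : ℝ) 1) :
    diffOp (-s) (restr d (radialTerm p Y)) ξ t
      = -n * (n - s + d - 1) * polar (restr d (radialTerm p Y)) ξ t := by
  have ht' : t ∈ Icc (0 : ℝ) 1 := Ioc_subset_Icc_self ht
  have hu : UniqueDiffOn ℝ (Icc (0 : ℝ) 1) := uniqueDiffOn_Icc one_pos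
  set P : Polynomial ℝ := p * Polynomial.X ^ m with hP
  set c : ℝ := MvPolynomial.eval (fun i => ξ i) Y with hc
  have heq : EqOn (fun τ => polar (restr d (radialTerm p Y)) ξ τ)
      (fun τ => (Polynomial.C c * P).eval τ) (Icc 0 1) := fun τ hτ => by
    change polar (restr d (radialTerm p Y)) ξ τ = (Polynomial.C c * P).eval τ
    rw [polar_radialTerm p hY.1 hξ hτ, ← hP, ← hc, Polynomial.eval_C_mul, mul_comm]
  have hd1 : derivWithin (fun τ => polar (restr d (radialTerm p Y)) ξ τ) (Icc 0 1) t
      = c * (Polynomial.derivative P).eval t := by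
    rw [derivWithin_congr heq (heq ht'),
      ((Polynomial.C c * P).hasDerivAt t).hasDerivWithinAt.derivWithin (hu t ht')]
    simp
  have hd2 : iteratedDerivWithin 2 (fun τ => polar (restr d (radialTerm p Y)) ξ τ) (Icc 0 1) t
      = c * (Polynomial.derivative (Polynomial.derivative P)).eval t := by
    rw [iteratedDerivWithin_congr heq ht',
      iteratedDerivWithin_eq_iteratedDeriv hu (contDiff_polynomial_eval _).contDiffAt ht',
      iteratedDeriv_succ, iteratedDeriv_one]
    have : deriv (fun τ => (Polynomial.C c * P).eval τ)
        = fun τ => (Polynomial.derivative (Polynomial.C c * P)).eval τ := by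
      ext τ
      exact Polynomial.deriv _
    rw [this, Polynomial.deriv]
    simp
  rw [diffOp, hd1, hd2, laplaceBeltrami_radialTerm p hY hξ ht', polar_radialTerm p hY.1 hξ ht',
    ← hP, ← hc]
  have h1 := X_mul_derivative_mul_X_pow p m
  -- From `t² d²/dt² = (t d/dt)² - t d/dt`.
  have h2 : Polynomial.X ^ 2 * Polynomial.derivative (Polynomial.derivative P)
      = (Polynomial.X ^ 2 * Polynomial.derivative (Polynomial.derivative p)
        + 2 * (m : Polynomial ℝ) * Polynomial.X * Polynomial.derivative p
        + (m : Polynomial ℝ) * ((m : Polynomial ℝ) - 1) * p) * Polynomial.X ^ m := by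
    have h3 : Polynomial.X * Polynomial.derivative (Polynomial.X * Polynomial.derivative P)
        = (Polynomial.X * Polynomial.derivative
          (Polynomial.X * Polynomial.derivative p + (m : Polynomial ℝ) * p)
          + (m : Polynomial ℝ) * (Polynomial.X * Polynomial.derivative p + (m : Polynomial ℝ) * p))
          * Polynomial.X ^ m := by
      rw [hP, X_mul_derivative_mul_X_pow, X_mul_derivative_mul_X_pow]
    rw [← hP] at h1
    simp only [Polynomial.derivative_mul, Polynomial.derivative_X, map_add,
      Polynomial.derivative_natCast] at h3
    linear_combination h3 - h1
  rw [← hP] at h1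
  have e1 := congrArg (Polynomial.eval t) h1
  have e2 := congrArg (Polynomial.eval t) h2
  have e0 := congrArg (Polynomial.eval t) hp
  have e3 : P.eval t = p.eval t * t ^ m := by simp [hP]
  simp only [jacobiOp, Polynomial.eval_mul, Polynomial.eval_add, Polynomial.eval_sub,
    Polynomial.eval_pow, Polynomial.eval_X, Polynomial.eval_natCast, Polynomial.eval_one,
    Polynomial.eval_C, Polynomial.eval_zero, Polynomial.eval_ofNat] at e0 e1 e2
  have ht0 : t ≠ 0 := ht.1.ne'
  -- After multiplication by `t` only `t P'` and `t² P''` occur, and the remaining constants combine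
  -- through `(n-m)(n+m+d-1-s) = n(n-s+d-1) - m(m+d-1-s)`.
  refine mul_left_cancel₀ ht0 ?_
  rw [e3]
  generalize (Polynomial.derivative (Polynomial.derivative P)).eval t = P2 at *
  generalize (Polynomial.derivative P).eval t = P1 at *
  generalize (Polynomial.derivative (Polynomial.derivative p)).eval t = p2 at *
  generalize (Polynomial.derivative p).eval t = p1 at *
  generalize p.eval t = p0 at *
  have ht1 : t * t⁻¹ = 1 := mul_inv_cancel₀ ht0
  linear_combination (c * (1 - t)) * e2 + (c * (d - 1 - (d + -s) * t)) * e1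
    + (c * t * t ^ m) * e0 + (-(m * (m + d - 2)) * (p0 * t ^ m * c)) * ht1

end ConicSurface

end

/-! ### The space `U_n` as a direct sum over the degree of the spherical part -/

noncomputable section

namespace ConicSurface

open MeasureTheory Set

lemma jacobiPoly_zero (α β : ℝ) : jacobiPoly 0 α β = 1 := by
  simp [jacobiPoly]

/-- The radial factor with which the solid harmonics of degree `k` occur in `U_n`. -/
def radialFactor (d n s k : ℕ) : Polynomial ℝ :=
  if k + s ≤ n then (1 - Polynomial.X) ^ s * monicJacobi (k + k + (d - 2)) s (n - s - k)
  else jacobiPoly (n - k) (2 * k + d - 2) (-s)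

lemma radialFactor_ne_zero {d : ℕ} (hd : 2 ≤ d) (n s k : ℕ) : radialFactor d n s k ≠ 0 := by
  rw [radialFactor]
  split_ifs
  · refine mul_ne_zero (pow_ne_zero s fun h => ?_) (monicJacobi_ne_zero _ _ _)
    simpa using congrArg (Polynomial.eval 0) h
  · have hd' : (2 : ℝ) ≤ d := by exact_mod_cast hd
    exact jacobiPoly_ne_zero _ (by linarith [Nat.cast_nonneg (α := ℝ) k]) _

/-- Both cases lead to the same eigenvalue: `N(N+a+s+1) + s(a+1)` with `N = n-s-k`, `a = 2k+d-2`,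
and `j(j+a-s+1)` with `j = n-k`, both equal `(n-k)(n+k+d-1-s)`. -/
lemma jacobiOp_radialFactor {d n s k : ℕ} (hd : 2 ≤ d) (hs : 2 ≤ s) (hk : k ≤ n) :
    jacobiOp (2 * k + d - 2) (-s) (radialFactor d n s k)
      + Polynomial.C (((n : ℝ) - k) * (n + k + d - 1 - s)) * radialFactor d n s k = 0 := by
  rw [radialFactor]
  split_ifs with h
  · have hN : ((n - s - k : ℕ) : ℝ) = n - s - k := by
      rw [Nat.cast_sub (by omega), Nat.cast_sub (by omega)]
    have ha : ((k + k + (d - 2) : ℕ) : ℝ) = 2 * k + d - 2 := by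
      rw [Nat.cast_add, Nat.cast_sub hd]
      push_cast
      ring
    have h1 := jacobiOp_one_sub_pow_mul hs
      (monicJacobi_isJacobiOrth (k + k + (d - 2)) s (n - s - k)).jacobiOp_add
    rw [hN, ha] at h1
    convert! h1 using 4
    ring
  · have h1 := jacobiOp_jacobiPoly (n - k) (2 * k + d - 2) (-s)
    rw [Nat.cast_sub hk] at h1
    convert! h1 using 4
    ring

lemma restr_radialTerm_mem_spaceU {d n s k : ℕ} (hd : 2 ≤ d) (hk : k ≤ n)
    {Y : MvPolynomial (Fin d) ℝ} (hY : Y ∈ harmonicSubmodule d k) :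
    restr d (radialTerm (radialFactor d n s k) Y) ∈ spaceU d n s := by
  have hY' := mem_harmonicSubmodule.mp hY
  refine Submodule.subset_span ?_
  rw [radialFactor]
  split_ifs with h
  · refine Or.inr ⟨by omega, _,
      restr_radialTerm_monicJacobi_mem_orthPoly (k := k) (m := n - s) hd s (by omega) hY, ?_⟩
    ext z
    simp only [restr_apply, eval_radialTerm, Polynomial.eval_mul, Polynomial.eval_pow,
      Polynomial.eval_sub, Polynomial.eval_one, Polynomial.eval_X]
    ring
  -- Here `n < k + s`, so `j = n - k` is at most `s - 1`; `j = 0` is the summand `H_n`.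
  · rcases hk.eq_or_lt with rfl | hk'
    · refine Or.inl (Or.inl ⟨Y, hY', ?_⟩)
      rw [restr_radialTerm, Nat.sub_self, jacobiPoly_zero]
      simp
    · refine Or.inl (Or.inr ⟨n - k, by omega, by omega, by omega, Y, ?_, ?_⟩)
      · rwa [Nat.sub_sub_self hk]
      · rw [restr_radialTerm]
        simp only [eval_jacobiPoly, Nat.cast_sub hk]
        congr
        ext t
        congr 1
        ring

lemma spaceU_le_span {d n s : ℕ} (hd : 2 ≤ d) (hs : 2 ≤ s) :
    spaceU d n s ≤ Submodule.span ℝ {f | ∃ k ≤ n, ∃ Y ∈ harmonicSubmodule d k,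
      f = restr d (radialTerm (radialFactor d n s k) Y)} := by
  refine Submodule.span_le.mpr ?_
  rintro f ((⟨Y, hY, rfl⟩ | ⟨j, hj1, hjs, hjn, Y, hY, rfl⟩) | ⟨hsn, g, hg, rfl⟩)
  · refine Submodule.subset_span ⟨n, le_rfl, Y, mem_harmonicSubmodule.mpr hY, ?_⟩
    rw [radialFactor, if_neg (by omega), restr_radialTerm, Nat.sub_self, jacobiPoly_zero]
    simp
  · refine Submodule.subset_span ⟨n - j, by omega, Y, mem_harmonicSubmodule.mpr hY, ?_⟩
    rw [radialFactor, if_neg (by omega), restr_radialTerm, Nat.sub_sub_self hjn]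
    simp only [eval_jacobiPoly, Nat.cast_sub hjn]
    congr
    ext t
    congr 1
    ring
  · obtain ⟨Y, hY, rfl⟩ := exists_of_mem_orthPoly hd s hg
    have hsum : (fun z : V0 d => (1 - z.1.2) ^ s * (∑ k ∈ Finset.range (n - s + 1),
        restr d (radialTerm (monicJacobi (k + k + (d - 2)) s (n - s - k)) (Y k))) z)
        = ∑ k ∈ Finset.range (n - s + 1), restr d (radialTerm (radialFactor d n s k) (Y k)) := by
      ext z
      rw [Finset.sum_apply, Finset.sum_apply, Finset.mul_sum]
      refine Finset.sum_congr rfl fun k hk => ?_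
      rw [Finset.mem_range] at hk
      rw [radialFactor, if_pos (by omega)]
      simp only [restr_apply, eval_radialTerm, Polynomial.eval_mul, Polynomial.eval_pow,
        Polynomial.eval_sub, Polynomial.eval_one, Polynomial.eval_X]
      ring
    rw [hsum]
    refine Submodule.sum_mem _ fun k hk => ?_
    rw [Finset.mem_range] at hk
    exact Submodule.subset_span ⟨k, by omega, Y k, hY k, rfl⟩

/-- The map `(Y_k) ↦ ∑ q_k(t) Y_k(x)` that parametrizes `U_n`. -/
def harmonicSum (d n s : ℕ) : (∀ k : Fin (n + 1), harmonicSubmodule d k) →ₗ[ℝ] (V0 d → ℝ) :=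
  ∑ k : Fin (n + 1), restr d ∘ₗ
    LinearMap.mulLeft ℝ
      (Polynomial.aeval (MvPolynomial.X (Sum.inr ())) (radialFactor d n s k)) ∘ₗ
    (MvPolynomial.rename Sum.inl).toLinearMap ∘ₗ (harmonicSubmodule d k).subtype ∘ₗ
    LinearMap.proj k

lemma harmonicSum_apply {d n s : ℕ} (Y : ∀ k : Fin (n + 1), harmonicSubmodule d k) :
    harmonicSum d n s Y = ∑ k : Fin (n + 1), restr d (radialTerm (radialFactor d n s k) (Y k).1) := by
  rw [harmonicSum, LinearMap.sum_apply]
  rfl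

lemma range_harmonicSum {d n s : ℕ} (hd : 2 ≤ d) (hs : 2 ≤ s) :
    LinearMap.range (harmonicSum d n s) = spaceU d n s := by
  refine le_antisymm ?_ ((spaceU_le_span hd hs).trans (Submodule.span_le.mpr ?_))
  · rintro _ ⟨Y, rfl⟩
    rw [harmonicSum_apply]
    exact Submodule.sum_mem _ fun k _ =>
      restr_radialTerm_mem_spaceU hd (Nat.lt_succ_iff.mp k.2) (Y k).2
  · rintro _ ⟨k, hk, Y, hY, rfl⟩
    refine ⟨Pi.single ⟨k, Nat.lt_succ_of_le hk⟩ ⟨Y, hY⟩, ?_⟩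
    rw [harmonicSum_apply, Finset.sum_eq_single_of_mem ⟨k, Nat.lt_succ_of_le hk⟩
      (Finset.mem_univ _)]
    · simp
    · intro j _ hj
      rw [Pi.single_eq_of_ne hj]
      simp [radialTerm]

/-- For fixed `t`, pairing a vanishing sum with `Y_l` on the sphere leaves `q_l(t) t^l ∫ Y_l² = 0`.
The polynomial `q_l(t) t^l` is nonzero, so it cannot vanish on all of `[0,1]`, and `Y_l = 0`. -/
lemma injective_harmonicSum {d n s : ℕ} (hd : 2 ≤ d) :
    Function.Injective (harmonicSum d n s) := by
  have hd0 : 0 < d := by omega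
  rw [← LinearMap.ker_eq_bot, LinearMap.ker_eq_bot']
  intro Y hY
  have hpt : ∀ t ∈ Icc (0 : ℝ) 1, ∀ ξ : Metric.sphere (0 : E d) 1,
      ∑ k : Fin (n + 1), (radialFactor d n s k * Polynomial.X ^ (k : ℕ)).eval t
        * MvPolynomial.eval (fun i => (ξ : E d) i) (Y k).1 = 0 := by
    intro t ht ξ
    have h := congrFun hY ⟨_, smul_mem_V0 ξ.2 ht⟩
    rw [harmonicSum_apply, Finset.sum_apply] at h
    rw [← h.trans (Pi.zero_apply _)]
    refine Finset.sum_congr rfl fun k _ => ?_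
    rw [← polar_radialTerm _ (Y k).2.1 ξ.2 ht, polar_of_mem _ ξ.2 ht]
  funext l
  refine Subtype.ext (eq_zero_of_sphereInt_mul_self hd0 (Y l).2.1 ?_)
  have hzero : ∀ t ∈ Icc (0 : ℝ) 1, (radialFactor d n s l * Polynomial.X ^ (l : ℕ)).eval t
      * sphereInt d ((Y l).1 * (Y l).1) = 0 := by
    intro t ht
    have h0 : sphereInt d (∑ k : Fin (n + 1),
        (radialFactor d n s k * Polynomial.X ^ (k : ℕ)).eval t • ((Y k).1 * (Y l).1)) = 0 := by
      rw [sphereInt_apply]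
      refine integral_eq_zero_of_ae (Filter.Eventually.of_forall fun ξ => ?_)
      simp only [map_sum, MvPolynomial.smul_eval, map_mul, ← mul_assoc, ← Finset.sum_mul, hpt t ht ξ,
        zero_mul, Pi.zero_apply]
    rw [map_sum, Finset.sum_eq_single_of_mem l (Finset.mem_univ l)] at h0
    · simpa using h0
    · intro k _ hkl
      rw [map_smul, sphereInt_mul_eq_zero hd0 (fun h => hkl (Fin.ext h))
        (mem_harmonicSubmodule.mp (Y k).2) (mem_harmonicSubmodule.mp (Y l).2), smul_zero]
  by_contra hne
  refine mul_ne_zero (radialFactor_ne_zero hd n s l) (pow_ne_zero (l : ℕ) Polynomial.X_ne_zero)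
    (Polynomial.eq_zero_of_infinite_isRoot _ ((Icc_infinite (zero_lt_one' ℝ)).mono fun t ht => ?_))
  exact (mul_eq_zero.mp (hzero t ht)).resolve_right hne

lemma finrank_spaceU {d n s : ℕ} (hd : 2 ≤ d) (hs : 2 ≤ s) :
    Module.finrank ℝ (spaceU d n s)
      = (n + d - 1).choose (d - 1) + (n + d - 2).choose (d - 1) := by
  rw [← range_harmonicSum hd hs, LinearMap.finrank_range_of_inj (injective_harmonicSum hd),
    Module.finrank_pi_fintype, ← sum_finrank_harmonicSubmodule hd]
  exact Fin.sum_univ_eq_sum_range (fun k => Module.finrank ℝ (harmonicSubmodule d k)) (n + 1)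

/-- Smoothness is carried through the span induction because the linearity of `diffOp` depends on
it. -/
lemma diffOp_of_mem_spaceU {d n s : ℕ} (hd : 2 ≤ d) (hs : 2 ≤ s) {Z : V0 d → ℝ}
    (hZ : Z ∈ spaceU d n s) :
    ConeSmooth Z ∧ ∀ ξ ∈ Metric.sphere (0 : E d) 1, ∀ t ∈ Ioc (0 : ℝ) 1,
      diffOp (-(s : ℝ)) Z ξ t = -(n : ℝ) * ((n : ℝ) - s + d - 1) * polar Z ξ t := by
  replace hZ := spaceU_le_span hd hs hZ
  induction hZ using Submodule.span_induction with
  | mem f hf =>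
    obtain ⟨k, hk, Y, hY, rfl⟩ := hf
    exact ⟨coneSmooth_radialTerm _ hY.1, fun ξ hξ t ht =>
      diffOp_radialTerm (mem_harmonicSubmodule.mp hY) (jacobiOp_radialFactor hd hs hk) hξ ht⟩
  | zero => exact ⟨ConeSmooth.zero, fun ξ _ t _ => by rw [diffOp_zero, polar_zero, mul_zero]⟩
  | add f g _ _ hf hg =>
    refine ⟨hf.1.add hg.1, fun ξ hξ t ht => ?_⟩
    rw [diffOp_add _ hf.1 hg.1 hξ (Ioc_subset_Icc_self ht), hf.2 ξ hξ t ht, hg.2 ξ hξ t ht,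
      polar_add]
    ring
  | smul c f _ hf =>
    refine ⟨hf.1.smul c, fun ξ hξ t ht => ?_⟩
    rw [diffOp_smul _ hf.1 c hξ (Ioc_subset_Icc_self ht), hf.2 ξ hξ t ht, polar_smul]
    ring

end ConicSurface

end

theorem mainTheorem9 (d n s : ℕ) (hd : 2 ≤ d) (hs : 2 ≤ s) :
    (∀ Z ∈ ConicSurface.spaceU d n s,
      ∀ ξ ∈ Metric.sphere (0 : EuclideanSpace ℝ (Fin d)) 1, ∀ t ∈ Set.Ioc (0 : ℝ) 1,
        ConicSurface.diffOp (-(s : ℝ)) Z ξ t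
          = -(n : ℝ) * ((n : ℝ) - (s : ℝ) + (d : ℝ) - 1) * ConicSurface.polar Z ξ t) ∧
    ((∀ j : ℕ, 1 ≤ j → j ≤ s - 1 → j ≤ n →
        ¬ (1 ≤ -2 * (n : ℤ) - d + j + s + 2 ∧ -2 * (n : ℤ) - d + j + s + 2 ≤ j)) →
      Module.finrank ℝ (ConicSurface.spaceU d n s)
        = (n + d - 1).choose (d - 1) + (n + d - 2).choose (d - 1)) := by
  exact ⟨fun Z hZ => (ConicSurface.diffOp_of_mem_spaceU hd hs hZ).2,
    fun _ => ConicSurface.finrank_spaceU hd hs⟩
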